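/- Let $1\le k\le n$ and fix a directed graph $\Gamma$ on the nodes $\{0,1,\dots,n\}$ (for instance the complete one); all graphs below use only edges of $\Gamma$. Nodes $0,\dots,k$ are called special. We consider graphs with edges colored black or red and at most one edge out of each node. A meta-edge $s\to t$ is a directed path (with at least one edge) from $s$ to $t$. **Signed sets.** A signed set is a set $S=S^+\sqcup S^-$; the difference $S-T$ of two signed sets is the disjoint union of $S$ and $T$ with $(S-T)^+=S^+\sqcup T^-$ and $(S-T)^-=S^-\sqcup T^+$. * $S_1$ is the set of ordered $k$-tuples $(G_1,\dots,G_k)$ such that $G_1$ has one edge out of every node except $0$, and each of $G_2,\dots,G_k$ has one edge out of every non-special node and none out of the special nodes. Each cycle of each $G_i$ is either entirely red or entirely black; all edges not in cycles are black. * $S_2$ is the set of ordered $k$-tuples $(G_1,\dots,G_k)$ such that $G_i$ has one edge out of every non-special node and out of node $i$, and no edge out of the other special nodes. Here forbidden meta-cycles also count as cycles: these are given by distinct $a_1,\dots,a_r\in\{1,\dots,k\}$ such that $G_{a_j}$ contains a meta-edge $a_j\to a_{j+1}$ for all $j$ (indices mod $r$), and consist of all edges of these meta-edges. Each cycle is either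 entirely red or entirely black; all edges not in cycles are black. In both sets a tuple is positive if its number of red cycles is even and negative if it is odd. **The pairwise maps $\phi_1^i$.** In a tuple from $S_1$ put $\pi=G_1$ and $\tau_i=G_{i+1}$; in a tuple from $S_2$ put $\pi=G_k$ and $\tau_i=G_i$ $(1\le i\le k-1)$. So $\pi$ is the graph with an edge out of $k$. The map $\phi_1^i$ changes the current pair $(\pi,\tau_i)$ as follows. Let $F=\pi$, $R=\tau_i$, and let $m$ be the smallest node in $\{1,\dots,k\}$ with an edge out of it in $F$ or $R$. * If the edge out of $m$ is black, move it to the other graph. * If it is red, perform the crabwalk: move forward along red edges of $F$ and backward along red edges of $R$. If the edge out of $m$ is in $F$, begin by moving forward along it. If it is in $R$, let $v$ be the special node such that $R$ has a meta-edge $m\to v$, and begin by moving backward along the red edge of $R$ into $v$. After moving forward to a non-special node $y$, move backward along the red edge of $R$ into $y$ if there is one, and otherwise continue forward along the red edge of $F$ out of $y$. After moving backward to a non-special node $x$, move forward along the red edge of $F$ out of $x$ if there is one, and otherwise continue backward along the red edge of $R$ into $x$. Stop on reaching a special node; the crabwalk ends in $\pi$ if its last move was forward, and in $\tau_i$ if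 it was backward. Then, for each node that is the tail of a used edge, exchange between $F$ and $R$ the edges out of that node. (In the black case $\phi_1^i$ counts as not ending in $\pi$.) **The map $\phi_1$.** On a tuple from $S_1$, apply $\phi_1^1,\phi_1^2,\dots,\phi_1^{k-1}$ in this order, each to the current $\pi$ and $\tau_i$; the result $(\tau_1,\dots,\tau_{k-1},\pi)$ is regarded as a tuple of the $S_2$ part. On a tuple from $S_2$, apply $\phi_1^{k-1},\phi_1^{k-2},\dots$ in decreasing order. If none of them ends in $\pi$, continue through $\phi_1^1$; the result $(\pi,\tau_1,\dots,\tau_{k-1})$ is regarded as a tuple of the $S_1$ part. If $\phi_1^j$ is the first one that ends in $\pi$, then after it apply $\phi_1^{j+1},\phi_1^{j+2},\dots,\phi_1^{k-1}$ in increasing order; the result $(\tau_1,\dots,\tau_{k-1},\pi)$ is regarded as a tuple of the $S_2$ part. **Theorem.** The map $\phi_1$ sends $S_1-S_2$ to itself, it is an involution on $S_1-S_2$, and it is sign-reversing: it maps $(S_1-S_2)^+$ into $(S_1-S_2)^-$ and $(S_1-S_2)^-$ into $(S_1-S_2)^+$. -/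

import Mathlib

/-! ### Signed sets -/

/-- A signed set: a set split into two disjoint pieces, positive and negative. -/
structure SignedSet (α : Type*) where
  pos : Set α
  neg : Set α
  disj : Disjoint pos neg

namespace SignedSet

/-- The underlying set `S = S⁺ ⊔ S⁻`. -/
def carrier {α : Type*} (S : SignedSet α) : Set α := S.pos ∪ S.neg

/-- The difference `S - T`: the disjoint union of `S` (left summand) and `T` (right summand), with
`(S - T)⁺ = S⁺ ⊔ T⁻` and `(S - T)⁻ = S⁻ ⊔ T⁺`. -/
def difference {α β : Type*} (S : SignedSet α) (T : SignedSet β) : SignedSet (α ⊕ β) where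
  pos := Sum.inl '' S.pos ∪ Sum.inr '' T.neg
  neg := Sum.inl '' S.neg ∪ Sum.inr '' T.pos
  disj := by
    rw [Set.disjoint_left]
    rintro x (⟨a, ha, rfl⟩ | ⟨a, ha, rfl⟩) (⟨b, hb, h⟩ | ⟨b, hb, h⟩)
    · exact Set.disjoint_left.1 S.disj ha (Sum.inl_injective h ▸ hb)
    · exact absurd h (by simp)
    · exact absurd h (by simp)
    · exact Set.disjoint_left.1 T.disj (Sum.inr_injective h ▸ hb) ha

/-- `f` maps `S` to itself and is an involution on it. -/
def IsInvolution {α : Type*} (S : SignedSet α) (f : α → α) : Prop :=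
  Set.MapsTo f S.carrier S.carrier ∧ ∀ x ∈ S.carrier, f (f x) = x

/-- `f` sends `S⁺` to `S⁻` and `S⁻` to `S⁺`. -/
def IsSignReversing {α : Type*} (S : SignedSet α) (f : α → α) : Prop :=
  Set.MapsTo f S.pos S.neg ∧ Set.MapsTo f S.neg S.pos

end SignedSet

/-! ### Colored functional graphs -/

/-- The two edge colors. -/
inductive EdgeColor
  | black
  | red

/-- A graph on the nodes `0, …, n` with colored edges and at most one edge out of each node:
`G x = none` if there is no edge out of `x`, and `G x = some (y, c)` if the edge out of `x`
is `x → y` with color `c`. -/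
abbrev ColoredGraph (n : ℕ) : Type := Fin (n + 1) → Option (Fin (n + 1) × EdgeColor)

namespace ColoredGraph

variable {n : ℕ}

/-- `x → y` is an edge of `G` (of either color). -/
def Arc (G : ColoredGraph n) (x y : Fin (n + 1)) : Prop := ∃ c, G x = some (y, c)

/-- `x → y` is a red edge of `G`. -/
def RedArc (G : ColoredGraph n) (x y : Fin (n + 1)) : Prop := G x = some (y, EdgeColor.red)

/-- There is an edge out of `x` in `G`. -/
def HasOut (G : ColoredGraph n) (x : Fin (n + 1)) : Prop := ∃ y, G.Arc x y

/-- The edge out of `x` in `G` exists and is black. -/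
def BlackOut (G : ColoredGraph n) (x : Fin (n + 1)) : Prop :=
  ∃ y, G x = some (y, EdgeColor.black)

/-- The edge out of `x` in `G` exists and is red. -/
def RedOut (G : ColoredGraph n) (x : Fin (n + 1)) : Prop := ∃ y, G.RedArc x y

/-- `G` has a meta-edge `s → t`, i.e. a path `s = u 0 → u 1 → ⋯ → u (r + 1) = t` with at least one
edge, and `P` is the set of tails of its edges. For `s = t` this is a (simple) cycle through `s`. -/
def IsMetaEdge (G : ColoredGraph n) (s t : Fin (n + 1)) (P : Finset (Fin (n + 1))) : Prop :=
  ∃ (r : ℕ) (u : ℕ → Fin (n + 1)), u 0 = s ∧ u (r + 1) = t ∧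
    (∀ j ≤ r, G.Arc (u j) (u (j + 1))) ∧
    Set.InjOn u (Set.Icc 0 r) ∧ Set.InjOn u (Set.Icc 1 (r + 1)) ∧
    P = (Finset.range (r + 1)).image u

end ColoredGraph

/-! ### Tuples of graphs, their cycles and forbidden meta-cycles

Tuples are indexed by `Fin k`; the index `i : Fin k` is the `(i + 1)`-st graph.
An edge of a tuple is named by the pair (index of its graph, tail of the edge), and a cycle
or meta-cycle is identified with its set of edges. -/

/-- Ordered `k`-tuples of colored graphs on the nodes `0, …, n`. -/
abbrev GraphTuple (n k : ℕ) : Type := Fin k → ColoredGraph n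

namespace GraphTuple

variable {n k : ℕ}

/-- The node `i + 1` (one of `1, …, k`), for `k ≤ n`. -/
def node (n : ℕ) {k : ℕ} (i : Fin k) : Fin (n + 1) := Fin.ofNat (n + 1) (i + 1)

/-- `C` is (the edge set of) a cycle in one of the graphs of `T`. -/
def IsCycle (T : GraphTuple n k) (C : Finset (Fin k × Fin (n + 1))) : Prop :=
  ∃ (i : Fin k) (s : Fin (n + 1)) (P : Finset (Fin (n + 1))),
    (T i).IsMetaEdge s s P ∧ C = P.image (fun x => (i, x))

/-- `C` is (the edge set of) a forbidden meta-cycle of `T`: there are distinct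
`a 0, …, a r` in `{1, …, k}` such that the `a j`-th graph has a meta-edge `a j → a (j + 1)`
for every `j`, cyclically (the addition in `Fin (r + 1)` wraps around). -/
def IsForbiddenMetaCycle (T : GraphTuple n k) (C : Finset (Fin k × Fin (n + 1))) : Prop :=
  ∃ (r : ℕ) (a : Fin (r + 1) → Fin k) (P : Fin (r + 1) → Finset (Fin (n + 1))),
    Function.Injective a ∧
    (∀ j, (T (a j)).IsMetaEdge (node n (a j)) (node n (a (j + 1))) (P j)) ∧
    C = Finset.univ.biUnion (fun j => (P j).image (fun x => (a j, x)))

/-- All edges of `T` in `C` are red. -/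
def AllRed (T : GraphTuple n k) (C : Finset (Fin k × Fin (n + 1))) : Prop :=
  ∀ e ∈ C, (T e.1).RedOut e.2

/-- All edges of `T` in `C` are black. -/
def AllBlack (T : GraphTuple n k) (C : Finset (Fin k × Fin (n + 1))) : Prop :=
  ∀ e ∈ C, (T e.1).BlackOut e.2

/-- Relative to a notion `Cyc` of cycle, every cycle of `T` is entirely red or entirely black, and
all edges that are not in cycles are black. -/
def WellColored (T : GraphTuple n k) (Cyc : Finset (Fin k × Fin (n + 1)) → Prop) : Prop :=
  (∀ C, Cyc C → T.AllRed C ∨ T.AllBlack C) ∧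
  ∀ i x, (T i).RedOut x → ∃ C, Cyc C ∧ (i, x) ∈ C

/-- The number of red cycles of `T`, relative to a notion `Cyc` of cycle. -/
noncomputable def numRed (T : GraphTuple n k) (Cyc : Finset (Fin k × Fin (n + 1)) → Prop) : ℕ :=
  {C | Cyc C ∧ T.AllRed C}.ncard

/-- Every edge of every graph of `T` is an edge of the digraph `Γ`. -/
def EdgesIn (T : GraphTuple n k) (Γ : Digraph (Fin (n + 1))) : Prop :=
  ∀ i x y, (T i).Arc x y → Γ.Adj x y

/-- `T` belongs to `S₁`: the first graph has an edge out of every node except `0`, each other graph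
has an edge out of every non-special node (`> k`) and no edge out of the special nodes `0, …, k`;
cycles are red or black, and all other edges are black. -/
def MemS₁ (Γ : Digraph (Fin (n + 1))) (T : GraphTuple n k) : Prop :=
  T.EdgesIn Γ ∧
  (∀ (i : Fin k) (x : Fin (n + 1)),
    (T i).HasOut x ↔ if (i : ℕ) = 0 then x ≠ 0 else k < (x : ℕ)) ∧
  T.WellColored T.IsCycle

/-- The cycles of an element of `S₂`: any forbidden meta-cycle counts as a cycle. -/
def IsCycle₂ (T : GraphTuple n k) (C : Finset (Fin k × Fin (n + 1))) : Prop :=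
  T.IsCycle C ∨ T.IsForbiddenMetaCycle C

/-- `T` belongs to `S₂`: the `i`-th graph has an edge out of every non-special node and out of node
`i`, and no edge out of the other special nodes; cycles (including forbidden meta-cycles) are
red or black, and all other edges are black. -/
def MemS₂ (Γ : Digraph (Fin (n + 1))) (T : GraphTuple n k) : Prop :=
  T.EdgesIn Γ ∧
  (∀ (i : Fin k) (x : Fin (n + 1)), (T i).HasOut x ↔ k < (x : ℕ) ∨ x = node n i) ∧
  T.WellColored T.IsCycle₂

end GraphTuple

/-- The signed set `S₁`; the sign is the parity of the number of red cycles. -/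
def S₁ {n : ℕ} (k : ℕ) (Γ : Digraph (Fin (n + 1))) : SignedSet (GraphTuple n k) where
  pos := {T | T.MemS₁ Γ ∧ Even (T.numRed T.IsCycle)}
  neg := {T | T.MemS₁ Γ ∧ Odd (T.numRed T.IsCycle)}
  disj := Set.disjoint_left.2 fun _ h h' => Nat.not_even_iff_odd.2 h'.2 h.2

/-- The signed set `S₂`; the sign is the parity of the number of red cycles, where forbidden
meta-cycles count as cycles. -/
def S₂ {n : ℕ} (k : ℕ) (Γ : Digraph (Fin (n + 1))) : SignedSet (GraphTuple n k) where
  pos := {T | T.MemS₂ Γ ∧ Even (T.numRed T.IsCycle₂)}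
  neg := {T | T.MemS₂ Γ ∧ Odd (T.numRed T.IsCycle₂)}
  disj := Set.disjoint_left.2 fun _ h h' => Nat.not_even_iff_odd.2 h'.2 h.2

/-! ### The crabwalk and the maps `φ₁ⁱ`

`F` is the graph with the edge out of node `k` (dark red edges), `R` the other one (light red
edges). In the algorithm `F` is always the current `π` and `R` is `τᵢ`. -/

/-- A move of the crabwalk: `fwd x` goes forward along the dark red edge of `F` out of `x`;
`bwd x` goes backward along the light red edge of `R` out of `x`, so it arrives at `x`. -/
inductive CrabMove (n : ℕ)
  | fwd (x : Fin (n + 1))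
  | bwd (x : Fin (n + 1))

/-- The moves made by the crabwalk on `F`, `R` that starts from the node `m`. -/
inductive Crabwalk {n : ℕ} (k : ℕ) (F R : ColoredGraph n) (m : Fin (n + 1)) : CrabMove n → Prop
  /-- If the edge out of `m` is in `F`, begin by moving forward along it. -/
  | startF (h : F.RedOut m) : Crabwalk k F R m (.fwd m)
  /-- If the edge out of `m` is in `R`, and `m` is rooted in `R` at the special node `v`, begin by
  moving backward along the light red edge into `v`. -/
  | startR {v z : Fin (n + 1)} {P : Finset (Fin (n + 1))} (h : R.RedOut m)
      (hv : (v : ℕ) ≤ k) (hP : R.IsMetaEdge m v P) (hz : R.RedArc z v) : Crabwalk k F R m (.bwd z)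
  /-- Having moved forward to a non-special node with a light red edge into it, move backward
  along that edge. -/
  | fwdBwd {x y z : Fin (n + 1)} (h : Crabwalk k F R m (.fwd x)) (hx : F.RedArc x y)
      (hy : k < (y : ℕ)) (hz : R.RedArc z y) : Crabwalk k F R m (.bwd z)
  /-- Having moved forward to a non-special node without a light red edge into it, continue
  forward. -/
  | fwdFwd {x y : Fin (n + 1)} (h : Crabwalk k F R m (.fwd x)) (hx : F.RedArc x y)
      (hy : k < (y : ℕ)) (hz : ∀ z, ¬ R.RedArc z y) (hF : F.RedOut y) : Crabwalk k F R m (.fwd y)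
  /-- Having moved backward to a non-special node with a dark red edge out of it, move forward
  along that edge. -/
  | bwdFwd {x : Fin (n + 1)} (h : Crabwalk k F R m (.bwd x)) (hx : k < (x : ℕ))
      (hF : F.RedOut x) : Crabwalk k F R m (.fwd x)
  /-- Having moved backward to a non-special node without a dark red edge out of it, continue
  backward. -/
  | bwdBwd {x z : Fin (n + 1)} (h : Crabwalk k F R m (.bwd x)) (hx : k < (x : ℕ))
      (hF : ¬ F.RedOut x) (hz : R.RedArc z x) : Crabwalk k F R m (.bwd z)

/-- `m` is the smallest node with `1 ≤ m ≤ k` such that `F` or `R` has an edge out of `m`. -/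
def IsFirstNode {n : ℕ} (k : ℕ) (F R : ColoredGraph n) (m : Fin (n + 1)) : Prop :=
  IsLeast {x : Fin (n + 1) | 1 ≤ (x : ℕ) ∧ (x : ℕ) ≤ k ∧ (F.HasOut x ∨ R.HasOut x)} m

/-- The nodes whose out-edges change graphs under `φ₁ⁱ`. If the edge out of `m` is black, this is
only `m`; if it is red, these are the tails of the edges used by the crabwalk (a black edge of the
other graph out of such a node is moved in exchange). -/
def movedNodes {n : ℕ} (k : ℕ) (F R : ColoredGraph n) : Set (Fin (n + 1)) :=
  {x | ∃ m, IsFirstNode k F R m ∧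
    (((F.BlackOut m ∨ R.BlackOut m) ∧ x = m) ∨
     ((F.RedOut m ∨ R.RedOut m) ∧ (Crabwalk k F R m (.fwd x) ∨ Crabwalk k F R m (.bwd x))))}

/-- The crabwalk on `F`, `R` takes place and ends in `F`, i.e. its last move goes forward along an
edge of `F` into a special node. -/
def EndsInF {n : ℕ} (k : ℕ) (F R : ColoredGraph n) : Prop :=
  ∃ m, IsFirstNode k F R m ∧ (F.RedOut m ∨ R.RedOut m) ∧
    ∃ x y : Fin (n + 1), Crabwalk k F R m (.fwd x) ∧ F.RedArc x y ∧ (y : ℕ) ≤ k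

open Classical in
/-- The map `φ₁ⁱ` on the pair `(π, τᵢ) = (F, R)`. -/
noncomputable def phiPair {n : ℕ} (k : ℕ) (F R : ColoredGraph n) :
    ColoredGraph n × ColoredGraph n :=
  (fun x => if x ∈ movedNodes k F R then R x else F x,
   fun x => if x ∈ movedNodes k F R then F x else R x)

/-! ### The map `φ₁`

Here `k = r + 1`. A state is the graph `π` (with the edge out of node `k`) and the ordered list
`τ₁, …, τ_{k-1}` of the other graphs, the index `j : Fin r` standing for `τ_{j+1}`. -/

/-- The current `π` and the graphs `τ`. -/
abbrev PiTau (n r : ℕ) : Type := ColoredGraph n × (Fin r → ColoredGraph n)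

/-- Apply the map `φ₁ⁱ` (with `i = j + 1`) to `π` and `τᵢ`, keeping the other graphs. -/
noncomputable def phiStep {n r : ℕ} (s : PiTau n r) (j : Fin r) : PiTau n r :=
  ((phiPair (r + 1) s.1 (s.2 j)).1, Function.update s.2 j (phiPair (r + 1) s.1 (s.2 j)).2)

/-- Apply the maps `φ₁ⁱ` along a list of indices, from left to right. -/
noncomputable def phiSteps {n r : ℕ} (s : PiTau n r) (l : List (Fin r)) : PiTau n r :=
  l.foldl phiStep s

open Classical in
/-- Apply the maps `φ₁ⁱ` along a list of indices up to and including the first one that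
ends in `π`; return the result and that index, if there is one. -/
noncomputable def phiUntil {n r : ℕ} (s : PiTau n r) : List (Fin r) → PiTau n r × Option (Fin r)
  | [] => (s, none)
  | j :: l => if EndsInF (r + 1) s.1 (s.2 j) then (phiStep s j, some j)
      else phiUntil (phiStep s j) l

/-- The map `φ₁` on the disjoint union of `k`-tuples of the `S₁` kind (`Sum.inl`; here `π` is the
first graph) and `k`-tuples of the `S₂` kind (`Sum.inr`; here `π` is the last graph).
From `S₁`: perform `φ₁¹, …, φ₁^{k-1}`; the result is in `S₂`. From `S₂`: perform
`φ₁^{k-1}, …, φ₁¹`; if none of them ends in `π`, the result is in `S₁`; if `φ₁ʲ` is the first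
one that ends in `π`, turn around after it and perform `φ₁^{j+1}, …, φ₁^{k-1}`; the result
is in `S₂`. -/
noncomputable def phi₁ {n r : ℕ} :
    GraphTuple n (r + 1) ⊕ GraphTuple n (r + 1) → GraphTuple n (r + 1) ⊕ GraphTuple n (r + 1)
  | .inl T =>
    let s := phiSteps (T 0, Fin.tail T) (List.finRange r)
    .inr (Fin.snoc (α := fun _ => ColoredGraph n) s.2 s.1)
  | .inr T =>
    match phiUntil (T (Fin.last r), Fin.init T) (List.finRange r).reverse with
    | (s, none) => .inl (Fin.cons (α := fun _ => ColoredGraph n) s.1 s.2)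
    | (s, some j) =>
      let s' := phiSteps s ((List.finRange r).filter (fun i => j < i))
      .inr (Fin.snoc (α := fun _ => ColoredGraph n) s'.2 s'.1)

/-! All stages of the algorithm use one notion of cycle. In every state a special node has an
out-edge in at most one graph, so "continue in the same graph at a non-special node, and in
whichever graph has an out-edge at a special node" is a deterministic rule on edges, `Follows`. Its
cycles are the cycles of an `S₁` tuple at one end and the cycles and forbidden meta-cycles of an
`S₂` tuple at the other (`isCycle_iff_isFollowCycle`, `isCycle₂_iff_isFollowCycle`).

A coloring is admissible exactly when `Follows` restricts to a permutation `σ` of the red edges. A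
red cycle of length `l` contributes `(-1) ^ (l - 1)` to `sign σ` and `(-1) ^ l` to `(-1) ^ #red
edges`, so the product of the two is `(-1)` to the number of red cycles (`HasSign`,
`wellColored_iff_hasSign`).

The existence of `σ` makes each graph `RedBalanced`, which makes every rule of the crabwalk
reversible. Hence the walk has one beginning and one end, which is established by counting heads and
tails rather than by listing moves (`CrabPair.ends_iff`), and after the exchange it makes the
reversed moves (`CrabPair.crabwalk_exchange`), so each `phiPair` undoes itself. The exchange
conjugates `σ` by a relabeling and multiplies it by one transposition for each node of
`CrabPair.Turn`. The number of these nodes is odd exactly when the walk begins in `τᵢ` and ends in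
`π` (`CrabPair.odd_card_turn_iff`), so only then does the sign change (`HasSign.exchange`).

Consequently a step moves the state up a level, down a level, or, when a downward step ends in `π`,
leaves the level fixed and reverses the sign. A run from one end to the other keeps the number of
red cycles modulo 2 and changes sides in `S₁ - S₂`; a run that turns around changes that parity once
and stays on its side. Both reverse the sign, and since steps are self-inverse, a second run
retraces the first. -/

namespace ColoredGraph

/-! ### Red edges in a single graph -/

variable {n k : ℕ} {F R F' R' G : ColoredGraph n} {m x y z v : Fin (n + 1)}

lemma RedArc.head_eq {y' : Fin (n + 1)} (h : G.RedArc x y) (h' : G.RedArc x y') : y = y' := by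
  unfold RedArc at h h'
  rw [h] at h'
  simpa using h'

lemma RedArc.redOut (h : G.RedArc x y) : G.RedOut x := ⟨y, h⟩

lemma RedArc.congr (h : G.RedArc x y) (e : F x = G x) : F.RedArc x y := by
  unfold RedArc at *
  rw [e, h]

lemma RedOut.congr (h : G.RedOut x) (e : F x = G x) : F.RedOut x :=
  h.imp fun _ h => h.congr e

/-- At every node at most one red edge of `G` comes in, and at a non-special node one comes in if
and only if one goes out. -/
structure RedBalanced (k : ℕ) (G : ColoredGraph n) : Prop where
  out_iff : ∀ y : Fin (n + 1), k < (y : ℕ) → (G.RedOut y ↔ ∃ x, G.RedArc x y)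
  inj : ∀ x x' y, G.RedArc x y → G.RedArc x' y → x = x'

open Classical in
/-- Counting a set of red edges by tails or by heads gives the same result. -/
lemma RedBalanced.card_tails (hG : G.RedBalanced k) (p : Fin (n + 1) → Prop) :
    (Finset.univ.filter fun x => p x ∧ ∃ y : Fin (n + 1), k < (y : ℕ) ∧ G.RedArc x y).card =
      (Finset.univ.filter fun y : Fin (n + 1) => k < (y : ℕ) ∧ ∃ x, p x ∧ G.RedArc x y).card := by
  refine Finset.card_bij (fun x hx => (Finset.mem_filter.1 hx).2.2.choose) ?_ ?_ ?_
  · intro x hx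
    have h := (Finset.mem_filter.1 hx).2.2.choose_spec
    exact Finset.mem_filter.2 ⟨Finset.mem_univ _, h.1, x, (Finset.mem_filter.1 hx).2.1, h.2⟩
  · intro x hx x' hx' he
    have h := (Finset.mem_filter.1 hx).2.2.choose_spec
    have h' := (Finset.mem_filter.1 hx').2.2.choose_spec
    rw [← he] at h'
    exact hG.inj _ _ _ h.2 h'.2
  · intro y hy
    obtain ⟨-, hky, x, hp, hx⟩ := Finset.mem_filter.1 hy
    have hx' : x ∈ Finset.univ.filter
        fun x => p x ∧ ∃ y : Fin (n + 1), k < (y : ℕ) ∧ G.RedArc x y :=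
      Finset.mem_filter.2 ⟨Finset.mem_univ _, hp, y, hky, hx⟩
    exact ⟨x, hx', (Finset.mem_filter.1 hx').2.2.choose_spec.2.head_eq hx⟩

open Classical in
/-- The numbers of edges in a set of red edges that begin or end at special nodes, compared. -/
lemma RedBalanced.card_special (hG : G.RedBalanced k) (p : Fin (n + 1) → Prop)
    (hp : ∀ x, p x → G.RedOut x) :
    (Finset.univ.filter fun x => p x ∧ ∃ y : Fin (n + 1), (y : ℕ) ≤ k ∧ G.RedArc x y).card +
      (Finset.univ.filter fun y : Fin (n + 1) => k < (y : ℕ) ∧ ∃ x, p x ∧ G.RedArc x y).card =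
    (Finset.univ.filter fun x : Fin (n + 1) => (x : ℕ) ≤ k ∧ p x).card +
      (Finset.univ.filter fun x : Fin (n + 1) => k < (x : ℕ) ∧ p x).card := by
  rw [← hG.card_tails p, ← Finset.card_union_of_disjoint, ← Finset.card_union_of_disjoint]
  · congr 1
    ext x
    simp only [Finset.mem_union, Finset.mem_filter, Finset.mem_univ, true_and]
    constructor
    · rintro (h | h)
      · exact (le_or_gt (x : ℕ) k).imp (fun h' => ⟨h', h.1⟩) fun h' => ⟨h', h.1⟩
      · exact (le_or_gt (x : ℕ) k).imp (fun h' => ⟨h', h.1⟩) fun h' => ⟨h', h.1⟩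
    · intro h
      have hpx : p x := h.elim And.right And.right
      obtain ⟨y, hy⟩ := hp x hpx
      exact (le_or_gt (y : ℕ) k).imp (fun h' => ⟨hpx, y, h', hy⟩) fun h' => ⟨hpx, y, h', hy⟩
  · rw [Finset.disjoint_filter]
    exact fun x _ h h' => absurd h.1 (not_le.2 h'.1)
  · rw [Finset.disjoint_filter]
    rintro x - ⟨-, y, hy, h⟩ ⟨-, y', hy', h'⟩
    rw [h.head_eq h'] at hy
    omega

open Classical in
-- At non-special nodes red heads and red tails cancel, so the excess at the special nodes is zero.
-- For `R` both sides are at most 1, which makes the start of a backward crabwalk unambiguous.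
lemma RedBalanced.card_special_tails (hG : G.RedBalanced k) :
    (Finset.univ.filter fun x => ∃ y : Fin (n + 1), (y : ℕ) ≤ k ∧ G.RedArc x y).card =
      (Finset.univ.filter fun x : Fin (n + 1) => (x : ℕ) ≤ k ∧ G.RedOut x).card := by
  have h := hG.card_special G.RedOut fun _ h => h
  have h1 : (Finset.univ.filter fun y : Fin (n + 1) => k < (y : ℕ) ∧ ∃ x, G.RedOut x ∧ G.RedArc x y)
      = Finset.univ.filter fun x : Fin (n + 1) => k < (x : ℕ) ∧ G.RedOut x := by
    refine Finset.filter_congr fun y _ => and_congr_right fun hy => ?_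
    rw [hG.out_iff y hy]
    exact ⟨fun ⟨x, hx⟩ => ⟨x, hx.2⟩, fun ⟨x, hx⟩ => ⟨x, hx.redOut, hx⟩⟩
  have h2 : (Finset.univ.filter fun x => G.RedOut x ∧ ∃ y : Fin (n + 1), (y : ℕ) ≤ k ∧ G.RedArc x y)
      = Finset.univ.filter fun x => ∃ y : Fin (n + 1), (y : ℕ) ≤ k ∧ G.RedArc x y :=
    Finset.filter_congr fun x _ => and_iff_right_of_imp fun ⟨y, hy⟩ => hy.2.redOut
  rw [h1, h2] at h
  omega

/-- A walk with at least one edge can be shortened to a path. -/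
lemma exists_isMetaEdge (h : Relation.TransGen G.Arc x y) : ∃ P, G.IsMetaEdge x y P := by
  classical
  have ex : ∃ (r : ℕ) (u : ℕ → Fin (n + 1)), u 0 = x ∧ u (r + 1) = y ∧
      ∀ j ≤ r, G.Arc (u j) (u (j + 1)) := by
    induction h with
    | @single b h =>
      exact ⟨0, fun j => if j = 0 then x else b, by simp, by simp, by
        intro j hj; obtain rfl : j = 0 := by omega
        simpa using h⟩
    | @tail b c _ h ih =>
      obtain ⟨r, u, h0, h1, h2⟩ := ih
      refine ⟨r + 1, fun j => if j ≤ r + 1 then u j else c, by simpa using h0, by simp, ?_⟩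
      intro j hj
      dsimp only
      rcases Nat.lt_or_ge j (r + 1) with h' | h'
      · rw [if_pos h'.le, if_pos (by omega)]
        exact h2 j (by omega)
      · obtain rfl : j = r + 1 := by omega
        rw [if_pos le_rfl, if_neg (by omega), h1]
        exact h
  obtain ⟨r, ⟨u, h0, h1, h2⟩, hr⟩ : ∃ r, (∃ u : ℕ → Fin (n + 1), u 0 = x ∧ u (r + 1) = y ∧
      ∀ j ≤ r, G.Arc (u j) (u (j + 1))) ∧ ∀ r' < r, ¬ ∃ u : ℕ → Fin (n + 1), u 0 = x ∧
      u (r' + 1) = y ∧ ∀ j ≤ r', G.Arc (u j) (u (j + 1)) :=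
    ⟨Nat.find ex, Nat.find_spec ex, fun _ => Nat.find_min ex⟩
  -- A repetition could be cut out of the shortest walk. The pair `(0, r + 1)` is excepted: the ends
  -- of a cycle agree, and cutting there would leave no edge.
  have hmin : ∀ i j, i < j → j ≤ r + 1 → (0 < i ∨ j ≤ r) → u i ≠ u j := by
    intro i j hij hj hor he
    refine hr (r - (j - i)) (by omega)
      ⟨fun l => if l ≤ i then u l else u (l + (j - i)), by simpa using h0, ?_, ?_⟩
    · dsimp only
      split_ifs with hl
      · obtain rfl : j = r + 1 := by omega
        rw [← h1, ← he]
        congr 1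
        omega
      · rw [← h1]
        congr 1
        omega
    · intro l hl
      dsimp only
      rcases lt_trichotomy l i with hli | rfl | hli
      · rw [if_pos hli.le, if_pos (by omega)]
        exact h2 l (by omega)
      · rw [if_pos le_rfl, if_neg (by omega), he]
        have := h2 j (by omega)
        rwa [show l + 1 + (j - l) = j + 1 by omega]
      · rw [if_neg (by omega), if_neg (by omega)]
        have := h2 (l + (j - i)) (by omega)
        rwa [show l + 1 + (j - i) = l + (j - i) + 1 by omega]
  refine ⟨_, r, u, h0, h1, h2, ?_, ?_, rfl⟩
  · intro i hi j hj he
    simp only [Set.mem_Icc] at hi hj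
    rcases lt_trichotomy i j with h' | h' | h'
    · exact absurd he (hmin i j h' (by omega) (by omega))
    · exact h'
    · exact absurd he.symm (hmin j i h' (by omega) (by omega))
  · intro i hi j hj he
    simp only [Set.mem_Icc] at hi hj
    rcases lt_trichotomy i j with h' | h' | h'
    · exact absurd he (hmin i j h' (by omega) (by omega))
    · exact h'
    · exact absurd he.symm (hmin j i h' (by omega) (by omega))

/-- A red edge out of a special node is the first edge of a red path to a special node. -/
lemma RedBalanced.exists_special (hG : G.RedBalanced k) (hm : (m : ℕ) ≤ k) (h : G.RedOut m) :
    ∃ v : Fin (n + 1), (v : ℕ) ≤ k ∧ Relation.TransGen G.RedArc m v := by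
  classical
  by_contra! hno
  have hred : ∀ x, Relation.ReflTransGen G.RedArc m x → G.RedOut x := by
    intro x hx
    rcases Relation.reflTransGen_iff_eq_or_transGen.1 hx with rfl | hx
    · exact h
    · have hk : k < (x : ℕ) := by
        by_contra hk
        exact hno x (by omega) hx
      obtain ⟨y, -, hy⟩ := Relation.TransGen.tail'_iff.1 hx
      exact (hG.out_iff x hk).2 ⟨y, hy⟩
  -- On the finite set of nodes reached from `m` the successor map is injective, hence onto. So it
  -- hits `m`, a special node, against the assumption that none is reached.
  let A := {x // Relation.ReflTransGen G.RedArc m x}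
  let f : A → A := fun a => ⟨(hred a.1 a.2).choose, a.2.tail (hred a.1 a.2).choose_spec⟩
  have hf : Function.Injective f := by
    intro a b hab
    have h1 := (hred a.1 a.2).choose_spec
    have h2 := (hred b.1 b.2).choose_spec
    have h3 : (hred a.1 a.2).choose = (hred b.1 b.2).choose := congrArg Subtype.val hab
    rw [← h3] at h2
    exact Subtype.ext (hG.inj _ _ _ h1 h2)
  obtain ⟨a, ha⟩ := Finite.surjective_of_injective hf ⟨m, .refl⟩
  have h1 := (hred a.1 a.2).choose_spec
  have h3 : (hred a.1 a.2).choose = m := congrArg Subtype.val ha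
  rw [h3] at h1
  exact hno m hm (Relation.TransGen.tail' a.2 h1)

/-- Provides the data required by `Crabwalk.startR`, so a crabwalk from a red edge of `R` does
begin. -/
lemma RedBalanced.exists_rooted (hG : G.RedBalanced k) (hm : (m : ℕ) ≤ k) (h : G.RedOut m) :
    ∃ (v z : Fin (n + 1)) (P : Finset (Fin (n + 1))), (v : ℕ) ≤ k ∧ G.IsMetaEdge m v P ∧
      G.RedArc z v := by
  obtain ⟨v, hv, hmv⟩ := hG.exists_special hm h
  obtain ⟨z, -, hz⟩ := Relation.TransGen.tail'_iff.1 hmv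
  obtain ⟨P, hP⟩ := exists_isMetaEdge (G := G)
    (Relation.TransGen.mono (fun _ _ h => ⟨EdgeColor.red, h⟩) _ _ hmv)
  exact ⟨v, z, P, hv, hP, hz⟩

end ColoredGraph

open ColoredGraph

/-! ### The crabwalk as a reversible path -/

namespace Crabwalk

variable {n k : ℕ} {F R : ColoredGraph n} {m x y z : Fin (n + 1)}

lemma redOut_fwd (h : Crabwalk k F R m (.fwd x)) : F.RedOut x := by
  cases h <;> assumption

lemma redOut_bwd (h : Crabwalk k F R m (.bwd x)) : R.RedOut x := by
  cases h with
  | startR _ _ _ hz => exact hz.redOut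
  | fwdBwd _ _ _ hz => exact hz.redOut
  | bwdBwd _ _ _ hz => exact hz.redOut

lemma eq_of_fwd_special (h : Crabwalk k F R m (.fwd x)) (hx : (x : ℕ) ≤ k) : x = m := by
  cases h with
  | startF => rfl
  | fwdFwd _ _ hy => omega
  | bwdFwd _ hx' => omega

end Crabwalk

/-- The conditions on the pair `(F, R)` under which the crabwalk from `m` is a path. -/
structure CrabPair {n : ℕ} (k : ℕ) (F R : ColoredGraph n) (m : Fin (n + 1)) : Prop where
  balF : F.RedBalanced k
  balR : R.RedBalanced k
  le : (m : ℕ) ≤ k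
  red : F.RedOut m ∨ R.RedOut m
  not_both : F.RedOut m → ¬ R.RedOut m
  special : ∀ x : Fin (n + 1), (x : ℕ) ≤ k → R.RedOut x → x = m

/-- Exchange forward and backward moves. -/
def CrabMove.reverse {n : ℕ} : CrabMove n → CrabMove n
  | .fwd x => .bwd x
  | .bwd x => .fwd x

namespace CrabPair

variable {n k : ℕ} {F R F' R' : ColoredGraph n} {m x y z v : Fin (n + 1)}

/-- This and the next three lemmas describe a non-special node completely: with red edges in both
graphs, the two incoming edges are paired and so are the two outgoing ones; with red edges in one
graph only, its incoming edge is paired with its outgoing edge. Each move has a unique predecessor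
because red in-degrees are at most one, so membership in the walk passes both ways along a pair. -/
lemma fwd_iff_bwd_of_head (h : CrabPair k F R m) (hy : k < (y : ℕ)) (hx : F.RedArc x y)
    (hz : R.RedArc z y) : Crabwalk k F R m (.fwd x) ↔ Crabwalk k F R m (.bwd z) := by
  constructor
  · exact fun hc => hc.fwdBwd hx hy hz
  · intro hc
    cases hc with
    | startR _ hv _ hz' => rw [hz'.head_eq hz] at hv; omega
    | fwdBwd hc hx' _ hz' =>
      rw [hz'.head_eq hz] at hx'
      rwa [h.balF.inj _ _ _ hx hx']
    | bwdBwd hc _ hF hz' =>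
      rw [hz'.head_eq hz] at hF
      exact absurd ((h.balF.out_iff y hy).2 ⟨x, hx⟩) hF

lemma fwd_iff_bwd_of_tail (h : CrabPair k F R m) (hx : k < (x : ℕ)) (hF : F.RedOut x)
    (hR : R.RedOut x) : Crabwalk k F R m (.fwd x) ↔ Crabwalk k F R m (.bwd x) := by
  constructor
  · intro hc
    cases hc with
    | startF => have := h.le; omega
    | fwdFwd _ _ _ hz =>
      obtain ⟨z, hz'⟩ := (h.balR.out_iff x hx).1 hR
      exact absurd hz' (hz z)
    | bwdFwd hc => exact hc
  · exact fun hc => hc.bwdFwd hx hF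

lemma fwd_iff_fwd (h : CrabPair k F R m) (hy : k < (y : ℕ)) (hx : F.RedArc x y)
    (hR : ¬ R.RedOut y) : Crabwalk k F R m (.fwd x) ↔ Crabwalk k F R m (.fwd y) := by
  constructor
  · exact fun hc => hc.fwdFwd hx hy (fun z hz => hR ((h.balR.out_iff y hy).2 ⟨z, hz⟩))
      ((h.balF.out_iff y hy).2 ⟨x, hx⟩)
  · intro hc
    cases hc with
    | startF => have := h.le; omega
    | fwdFwd hc hx' => rwa [h.balF.inj _ _ _ hx hx']
    | bwdFwd hc => exact absurd hc.redOut_bwd hR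

lemma bwd_iff_bwd (h : CrabPair k F R m) (hy : k < (y : ℕ)) (hz : R.RedArc z y)
    (hF : ¬ F.RedOut y) : Crabwalk k F R m (.bwd z) ↔ Crabwalk k F R m (.bwd y) := by
  constructor
  · intro hc
    cases hc with
    | startR _ hv _ hz' => rw [hz'.head_eq hz] at hv; omega
    | fwdBwd hc hx' _ hz' =>
      rw [hz'.head_eq hz] at hx'
      exact absurd ((h.balF.out_iff y hy).2 ⟨_, hx'⟩) hF
    | bwdBwd hc _ _ hz' => rwa [← hz'.head_eq hz]
  · exact fun hc => hc.bwdBwd hy hF hz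

/-- The exchange is made by tails and ignores directions. Nothing is lost: if both edges out of a
node are red, both or neither are used. -/
lemma used_iff_fwd (h : CrabPair k F R m) (hF : F.RedOut x) :
    (Crabwalk k F R m (.fwd x) ∨ Crabwalk k F R m (.bwd x)) ↔ Crabwalk k F R m (.fwd x) := by
  refine or_iff_left_of_imp fun hc => ?_
  rcases le_or_gt (x : ℕ) k with hx | hx
  · obtain rfl := h.special x hx hc.redOut_bwd
    exact absurd hc.redOut_bwd (h.not_both hF)
  · exact hc.bwdFwd hx hF

lemma used_iff_bwd (h : CrabPair k F R m) (hR : R.RedOut x) :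
    (Crabwalk k F R m (.fwd x) ∨ Crabwalk k F R m (.bwd x)) ↔ Crabwalk k F R m (.bwd x) := by
  refine or_iff_right_of_imp fun hc => ?_
  rcases le_or_gt (x : ℕ) k with hx | hx
  · obtain rfl := h.special x hx hR
    exact absurd hR (h.not_both hc.redOut_fwd)
  · exact (h.fwd_iff_bwd_of_tail hx hc.redOut_fwd hR).1 hc

/-- The crabwalk changes direction an odd number of times at the non-special node `y`. -/
def Turn (k : ℕ) (F R : ColoredGraph n) (m y : Fin (n + 1)) : Prop :=
  k < (y : ℕ) ∧
    ¬ ((∃ x, Crabwalk k F R m (.fwd x) ∧ F.RedArc x y) ↔ Crabwalk k F R m (.fwd y))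

lemma exists_fwd_iff (h : CrabPair k F R m) (hx : F.RedArc x y) :
    (∃ x, Crabwalk k F R m (.fwd x) ∧ F.RedArc x y) ↔ Crabwalk k F R m (.fwd x) :=
  ⟨fun ⟨_, hc, hx'⟩ => by rwa [h.balF.inj _ _ _ hx hx'], fun hc => ⟨x, hc, hx⟩⟩

lemma exists_bwd_iff (h : CrabPair k F R m) (hx : R.RedArc x y) :
    (∃ x, Crabwalk k F R m (.bwd x) ∧ R.RedArc x y) ↔ Crabwalk k F R m (.bwd x) :=
  ⟨fun ⟨_, hc, hx'⟩ => by rwa [h.balR.inj _ _ _ hx hx'], fun hc => ⟨x, hc, hx⟩⟩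

/-- Where only one graph has red edges, the walk goes straight through or does not come at all. -/
lemma turn_redOut (h : CrabPair k F R m) (ht : Turn k F R m y) : F.RedOut y ∧ R.RedOut y := by
  have hF : F.RedOut y := by
    by_contra hF
    refine ht.2 (iff_of_false ?_ fun hc => hF hc.redOut_fwd)
    rintro ⟨x, -, hx⟩
    exact hF ((h.balF.out_iff y ht.1).2 ⟨x, hx⟩)
  refine ⟨hF, ?_⟩
  by_contra hR
  obtain ⟨x, hx⟩ := (h.balF.out_iff y ht.1).1 hF
  exact ht.2 ((h.exists_fwd_iff hx).trans (h.fwd_iff_fwd ht.1 hx hR))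

lemma turn_iff_fwd (h : CrabPair k F R m) (hy : k < (y : ℕ)) (hx : F.RedArc x y) :
    Turn k F R m y ↔ ¬ (Crabwalk k F R m (.fwd x) ↔ Crabwalk k F R m (.fwd y)) := by
  rw [Turn, h.exists_fwd_iff hx, and_iff_right hy]

/-- `Turn` is defined through `F`, but the pairing of heads and of tails makes it symmetric in `F`
and `R`. -/
lemma turn_iff_bwd (h : CrabPair k F R m) (hy : k < (y : ℕ)) (hz : R.RedArc z y) :
    Turn k F R m y ↔ ¬ (Crabwalk k F R m (.bwd z) ↔ Crabwalk k F R m (.bwd y)) := by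
  by_cases hF : F.RedOut y
  · obtain ⟨x, hx⟩ := (h.balF.out_iff y hy).1 hF
    rw [h.turn_iff_fwd hy hx, h.fwd_iff_bwd_of_head hy hx hz,
      h.fwd_iff_bwd_of_tail hy hF ((h.balR.out_iff y hy).2 ⟨z, hz⟩)]
  · exact iff_of_false (fun ht => hF (h.turn_redOut ht).1)
      (not_not.2 (h.bwd_iff_bwd hy hz hF))

open Classical in
-- "As many ends as beginnings": the pairs at each non-special node cancel, so only moves that leave
-- or enter special nodes remain. On the left are the moves arriving at a special node, on the right
-- those departing from one.
lemma card_ends_add (h : CrabPair k F R m) :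
    (Finset.univ.filter fun x => Crabwalk k F R m (.fwd x) ∧
      ∃ y : Fin (n + 1), (y : ℕ) ≤ k ∧ F.RedArc x y).card +
    (Finset.univ.filter fun x : Fin (n + 1) => (x : ℕ) ≤ k ∧ Crabwalk k F R m (.bwd x)).card =
    (Finset.univ.filter fun x : Fin (n + 1) => (x : ℕ) ≤ k ∧ Crabwalk k F R m (.fwd x)).card +
    (Finset.univ.filter fun x => Crabwalk k F R m (.bwd x) ∧
      ∃ y : Fin (n + 1), (y : ℕ) ≤ k ∧ R.RedArc x y).card := by
  have h1 := h.balF.card_special (fun x => Crabwalk k F R m (.fwd x)) fun _ hc => hc.redOut_fwd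
  have h2 := h.balR.card_special (fun x => Crabwalk k F R m (.bwd x)) fun _ hc => hc.redOut_bwd
  have h3 : (Finset.univ.filter fun y : Fin (n + 1) => k < (y : ℕ) ∧
        ∃ x, Crabwalk k F R m (.fwd x) ∧ F.RedArc x y).card +
      (Finset.univ.filter fun x : Fin (n + 1) => k < (x : ℕ) ∧ Crabwalk k F R m (.bwd x)).card =
      (Finset.univ.filter fun y : Fin (n + 1) => k < (y : ℕ) ∧
        ∃ x, Crabwalk k F R m (.bwd x) ∧ R.RedArc x y).card +
      (Finset.univ.filter fun x : Fin (n + 1) => k < (x : ℕ) ∧ Crabwalk k F R m (.fwd x)).card := by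
    simp only [Finset.card_filter, ← Finset.sum_add_distrib]
    refine Finset.sum_congr rfl fun y _ => ?_
    by_cases hy : k < (y : ℕ)
    · simp only [hy, true_and]
      by_cases hF : F.RedOut y
      · obtain ⟨x, hx⟩ := (h.balF.out_iff y hy).1 hF
        rw [if_congr (h.exists_fwd_iff hx) rfl rfl]
        by_cases hR : R.RedOut y
        · obtain ⟨z, hz⟩ := (h.balR.out_iff y hy).1 hR
          rw [if_congr (h.exists_bwd_iff hz) rfl rfl,
            if_congr (h.fwd_iff_bwd_of_head hy hx hz) rfl rfl,
            if_congr (h.fwd_iff_bwd_of_tail hy hF hR) rfl rfl]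
        · rw [if_congr (h.fwd_iff_fwd hy hx hR) rfl rfl,
            if_neg fun hc : Crabwalk k F R m (.bwd y) => hR hc.redOut_bwd,
            if_neg fun hc : ∃ x, Crabwalk k F R m (.bwd x) ∧ R.RedArc x y =>
              hR ((h.balR.out_iff y hy).2 (hc.imp fun _ => And.right)), add_comm]
      · rw [if_neg fun ⟨x, _, hx⟩ => hF ((h.balF.out_iff y hy).2 ⟨x, hx⟩),
          if_neg fun hc : Crabwalk k F R m (.fwd y) => hF (hc.redOut_fwd)]
        by_cases hR : R.RedOut y
        · obtain ⟨z, hz⟩ := (h.balR.out_iff y hy).1 hR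
          rw [if_congr (h.exists_bwd_iff hz) rfl rfl, if_congr (h.bwd_iff_bwd hy hz hF) rfl rfl,
            add_comm]
        · rw [if_neg fun hc : Crabwalk k F R m (.bwd y) => hR hc.redOut_bwd,
            if_neg fun hc : ∃ x, Crabwalk k F R m (.bwd x) ∧ R.RedArc x y =>
              hR ((h.balR.out_iff y hy).2 (hc.imp fun _ => And.right))]
    · simp [hy]
  omega

lemma special_head_unique (h : CrabPair k F R m) {z z' v v' : Fin (n + 1)} (hv : (v : ℕ) ≤ k)
    (hv' : (v' : ℕ) ≤ k) (hz : R.RedArc z v) (hz' : R.RedArc z' v') : z = z' := by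
  classical
  have hc := h.balR.card_special_tails
  have hle : (Finset.univ.filter fun x : Fin (n + 1) => (x : ℕ) ≤ k ∧ R.RedOut x).card ≤ 1 := by
    refine Finset.card_le_one.2 fun a ha b hb => ?_
    simp only [Finset.mem_filter, Finset.mem_univ, true_and] at ha hb
    rw [h.special a ha.1 ha.2, h.special b hb.1 hb.2]
  rw [← hc] at hle
  exact Finset.card_le_one.1 hle z (by simpa using ⟨v, hv, hz⟩) z' (by simpa using ⟨v', hv', hz'⟩)

lemma redOut_of_special_head (h : CrabPair k F R m) (hv : (v : ℕ) ≤ k) (hz : R.RedArc z v) :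
    R.RedOut m := by
  classical
  have hc := h.balR.card_special_tails
  have hpos : 0 < (Finset.univ.filter fun x => ∃ y : Fin (n + 1), (y : ℕ) ≤ k ∧
      R.RedArc x y).card := Finset.card_pos.2 ⟨z, by simpa using ⟨v, hv, hz⟩⟩
  rw [hc] at hpos
  obtain ⟨x, hx⟩ := Finset.card_pos.1 hpos
  simp only [Finset.mem_filter, Finset.mem_univ, true_and] at hx
  rw [← h.special x hx.1 hx.2]
  exact hx.2

open Classical in
lemma card_special_fwd (h : CrabPair k F R m) :
    (Finset.univ.filter fun x : Fin (n + 1) => (x : ℕ) ≤ k ∧ Crabwalk k F R m (.fwd x)).card =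
      if F.RedOut m then 1 else 0 := by
  split_ifs with hF
  · refine Finset.card_eq_one.2 ⟨m, Finset.ext fun x => ?_⟩
    simp only [Finset.mem_filter, Finset.mem_univ, true_and, Finset.mem_singleton]
    refine ⟨fun hx => hx.2.eq_of_fwd_special hx.1, ?_⟩
    rintro rfl
    exact ⟨h.le, .startF hF⟩
  · refine Finset.card_eq_zero.2 (Finset.filter_eq_empty_iff.2 fun x _ hx => hF ?_)
    rw [← hx.2.eq_of_fwd_special hx.1]
    exact hx.2.redOut_fwd

open Classical in
lemma card_special_bwd (h : CrabPair k F R m) :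
    (Finset.univ.filter fun x : Fin (n + 1) => (x : ℕ) ≤ k ∧ Crabwalk k F R m (.bwd x)).card =
      if Crabwalk k F R m (.bwd m) then 1 else 0 := by
  split_ifs with hm
  · refine Finset.card_eq_one.2 ⟨m, Finset.ext fun x => ?_⟩
    simp only [Finset.mem_filter, Finset.mem_univ, true_and, Finset.mem_singleton]
    refine ⟨fun hx => h.special x hx.1 hx.2.redOut_bwd, ?_⟩
    rintro rfl
    exact ⟨h.le, hm⟩
  · refine Finset.card_eq_zero.2 (Finset.filter_eq_empty_iff.2 fun x _ hx => hm ?_)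
    have hxm := h.special x hx.1 hx.2.redOut_bwd
    rw [hxm] at hx
    exact hx.2

open Classical in
-- Together with `card_special_fwd` this shows that the walk has exactly one beginning, in `F` or in
-- `R`.
lemma card_starts (h : CrabPair k F R m) :
    (Finset.univ.filter fun x => Crabwalk k F R m (.bwd x) ∧
      ∃ y : Fin (n + 1), (y : ℕ) ≤ k ∧ R.RedArc x y).card = if F.RedOut m then 0 else 1 := by
  split_ifs with hF
  · refine Finset.card_eq_zero.2 (Finset.filter_eq_empty_iff.2 fun x _ hx => ?_)
    obtain ⟨-, y, hy, hx⟩ := hx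
    exact h.not_both hF (h.redOut_of_special_head hy hx)
  · have hR := h.red.resolve_left hF
    obtain ⟨v, z, P, hv, hP, hz⟩ := h.balR.exists_rooted h.le hR
    refine Finset.card_eq_one.2 ⟨z, Finset.ext fun x => ?_⟩
    simp only [Finset.mem_filter, Finset.mem_univ, true_and, Finset.mem_singleton]
    constructor
    · rintro ⟨-, y, hy, hx⟩
      exact h.special_head_unique hy hv hx hz
    · rintro rfl
      exact ⟨.startR hR hv hP hz, v, hv, hz⟩

/-- The crabwalk moves forward into a special node. -/
def Ends (k : ℕ) (F R : ColoredGraph n) (m : Fin (n + 1)) : Prop :=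
  ∃ x y : Fin (n + 1), Crabwalk k F R m (.fwd x) ∧ F.RedArc x y ∧ (y : ℕ) ≤ k

open Classical in
lemma card_ends (h : CrabPair k F R m) :
    (Finset.univ.filter fun x => Crabwalk k F R m (.fwd x) ∧
      ∃ y : Fin (n + 1), (y : ℕ) ≤ k ∧ F.RedArc x y).card =
      if Crabwalk k F R m (.bwd m) then 0 else 1 := by
  have h1 := h.card_ends_add
  rw [h.card_special_fwd, h.card_special_bwd, h.card_starts] at h1
  split_ifs at h1 ⊢ <;> omega

/-- One beginning forces one end, and the only backward arrival at a special node is along the edge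
out of `m`. -/
lemma ends_iff (h : CrabPair k F R m) : Ends k F R m ↔ ¬ Crabwalk k F R m (.bwd m) := by
  classical
  have h1 := h.card_ends
  constructor
  · rintro ⟨x, y, hc, hx, hy⟩ hm
    rw [if_pos hm, Finset.card_eq_zero, Finset.filter_eq_empty_iff] at h1
    exact h1 (Finset.mem_univ x) ⟨hc, y, hy, hx⟩
  · intro hm
    rw [if_neg hm] at h1
    obtain ⟨x, hx⟩ := Finset.card_eq_one.1 h1
    have hx : x ∈ Finset.univ.filter fun x => Crabwalk k F R m (.fwd x) ∧
      ∃ y : Fin (n + 1), (y : ℕ) ≤ k ∧ F.RedArc x y := by rw [hx]; simp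
    simp only [Finset.mem_filter, Finset.mem_univ, true_and] at hx
    obtain ⟨hc, y, hy, hx⟩ := hx
    exact ⟨x, y, hc, hx, hy⟩

open Classical in
/-- The crabwalk turns an odd number of times if and only if it begins backward and ends
forward. -/
lemma odd_card_turn_iff (h : CrabPair k F R m) :
    Odd (Finset.univ.filter (Turn k F R m)).card ↔ R.RedOut m ∧ Ends k F R m := by
  have h1 := h.balF.card_special (fun x => Crabwalk k F R m (.fwd x)) fun _ hc => hc.redOut_fwd
  rw [h.card_ends, h.card_special_fwd] at h1
  -- Turns are the nodes where exactly one of the `F`-edges in and out is used. So their number has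
  -- the parity of used heads plus used tails, which `h1` reduces to the boundary.
  have h2 : Finset.univ.filter (Turn k F R m) = symmDiff
      (Finset.univ.filter fun y : Fin (n + 1) => k < (y : ℕ) ∧
        ∃ x, Crabwalk k F R m (.fwd x) ∧ F.RedArc x y)
      (Finset.univ.filter fun x : Fin (n + 1) => k < (x : ℕ) ∧ Crabwalk k F R m (.fwd x)) := by
    ext y
    simp only [Turn, Finset.mem_symmDiff, Finset.mem_filter, Finset.mem_univ, true_and]
    generalize (∃ x, Crabwalk k F R m (.fwd x) ∧ F.RedArc x y) = p
    tauto
  have h3 : ∀ A B : Finset (Fin (n + 1)), (symmDiff A B).card + 2 * (A ∩ B).card =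
      A.card + B.card := by
    intro A B
    have e1 := Finset.card_sdiff_add_card_inter A B
    have e2 := Finset.card_sdiff_add_card_inter B A
    rw [Finset.inter_comm] at e2
    rw [symmDiff_def, Finset.sup_eq_union, Finset.card_union_of_disjoint]
    · omega
    · exact disjoint_sdiff_sdiff
  have h4 := h3 (Finset.univ.filter fun y : Fin (n + 1) => k < (y : ℕ) ∧
        ∃ x, Crabwalk k F R m (.fwd x) ∧ F.RedArc x y)
      (Finset.univ.filter fun x : Fin (n + 1) => k < (x : ℕ) ∧ Crabwalk k F R m (.fwd x))
  rw [← h2] at h4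
  have h5 : R.RedOut m ↔ ¬ F.RedOut m :=
    ⟨fun hR hF => h.not_both hF hR, fun hF => h.red.resolve_left hF⟩
  rw [h.ends_iff, h5, Nat.odd_iff]
  by_cases hF : F.RedOut m
  · have hb : ¬ Crabwalk k F R m (.bwd m) := fun hc => h.not_both hF hc.redOut_bwd
    simp only [hF, hb, if_true, if_false] at h1
    simp only [hF, not_true, false_and, iff_false]
    omega
  · by_cases hb : Crabwalk k F R m (.bwd m)
    · simp only [hF, hb, if_true, if_false] at h1
      simp only [hb, not_true, and_false, iff_false]
      omega
    · simp only [hF, hb, if_false] at h1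
      simp only [hF, hb, not_false_iff, and_self, iff_true]
      omega

/-- If `(F', R')` arises from `(F, R)` by exchanging at least the edges that the crabwalk uses,
then a crabwalk on `(F', R')` that starts with the reverse of one of its moves follows it. -/
lemma reverse_of_crabwalk (h : CrabPair k F R m) (h' : CrabPair k F' R' m)
    (hx : ∀ x, (F' x = F x ∧ R' x = R x) ∨ (F' x = R x ∧ R' x = F x))
    (hW : ∀ x, Crabwalk k F R m (.fwd x) ∨ Crabwalk k F R m (.bwd x) → F' x = R x ∧ R' x = F x)
    (hF : F'.RedOut m → Crabwalk k F R m (.bwd m))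
    (hR : R'.RedOut m → ∀ z v : Fin (n + 1), (v : ℕ) ≤ k → R'.RedArc z v →
      Crabwalk k F R m (.fwd z)) {a : CrabMove n} (ha : Crabwalk k F' R' m a) :
    Crabwalk k F R m a.reverse := by
  induction ha with
  | startF h0 => exact hF h0
  | startR h0 hv _ hz => exact hR h0 _ _ hv hz
  | @fwdBwd x y z hc hx' hy hz ih =>
    have ih : Crabwalk k F R m (.bwd x) := ih
    change Crabwalk k F R m (.fwd z)
    have hxy : R.RedArc x y := hx'.congr (hW x (.inr ih)).1.symm
    have hF'y := (h'.balF.out_iff y hy).2 ⟨_, hx'⟩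
    have hR'y := (h'.balR.out_iff y hy).2 ⟨_, hz⟩
    -- Both edges out of `y` are red after the exchange, so both were red before it, moved or not.
    have hFy : F.RedOut y := by
      rcases hx y with e | e
      · exact hF'y.congr e.1.symm
      · exact hR'y.congr e.2.symm
    obtain ⟨w, hw⟩ := (h.balF.out_iff y hy).1 hFy
    have hcw := (h.fwd_iff_bwd_of_head hy hw hxy).2 ih
    rwa [h'.balR.inj _ _ _ hz (hw.congr (hW w (.inl hcw)).2)]
  | @fwdFwd x y hc hx' hy hz hF' ih =>
    have ih : Crabwalk k F R m (.bwd x) := ih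
    change Crabwalk k F R m (.bwd y)
    have hxy : R.RedArc x y := hx'.congr (hW x (.inr ih)).1.symm
    have hR'y : ¬ R'.RedOut y := fun h0 => by
      obtain ⟨z, h0⟩ := (h'.balR.out_iff y hy).1 h0
      exact hz z h0
    have hRy := (h.balR.out_iff y hy).2 ⟨_, hxy⟩
    refine (h.bwd_iff_bwd hy hxy fun hFy => hR'y ?_).1 ih
    rcases hx y with e | e
    · exact hRy.congr e.2
    · exact hFy.congr e.2
  | @bwdFwd x hc hx' hF' ih =>
    have ih : Crabwalk k F R m (.fwd x) := ih
    change Crabwalk k F R m (.bwd x)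
    exact (h.fwd_iff_bwd_of_tail hx' ih.redOut_fwd (hF'.congr (hW x (.inl ih)).1.symm)).1 ih
  | @bwdBwd x z hc hx' hF' hz ih =>
    have ih : Crabwalk k F R m (.fwd x) := ih
    change Crabwalk k F R m (.fwd z)
    have hRx : ¬ R.RedOut x := fun h0 => hF' (h0.congr (hW x (.inl ih)).1)
    obtain ⟨w, hw⟩ := (h.balF.out_iff x hx').1 ih.redOut_fwd
    have hcw := (h.fwd_iff_fwd hx' hw hRx).2 ih
    rwa [h'.balR.inj _ _ _ hz (hw.congr (hW w (.inl hcw)).2)]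

/-- After the exchange of the edges used by the crabwalk, the crabwalk makes the reversed moves. -/
lemma crabwalk_exchange (h : CrabPair k F R m) (h' : CrabPair k F' R' m)
    (hW : ∀ x, Crabwalk k F R m (.fwd x) ∨ Crabwalk k F R m (.bwd x) → F' x = R x ∧ R' x = F x)
    (hN : ∀ x, ¬ (Crabwalk k F R m (.fwd x) ∨ Crabwalk k F R m (.bwd x)) →
      F' x = F x ∧ R' x = R x) (a : CrabMove n) :
    Crabwalk k F' R' m a ↔ Crabwalk k F R m a.reverse := by
  have hx : ∀ x, (F' x = F x ∧ R' x = R x) ∨ (F' x = R x ∧ R' x = F x) := fun x => by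
    by_cases hc : Crabwalk k F R m (.fwd x) ∨ Crabwalk k F R m (.bwd x)
    · exact .inr (hW x hc)
    · exact .inl (hN x hc)
  have key : ∀ a, Crabwalk k F' R' m a → Crabwalk k F R m a.reverse := by
    refine fun a => h.reverse_of_crabwalk h' hx hW ?_ ?_
    · intro hF'
      by_cases hc : Crabwalk k F R m (.fwd m) ∨ Crabwalk k F R m (.bwd m)
      · exact (h.used_iff_bwd (hF'.congr (hW m hc).1.symm)).1 hc
      · exact absurd (.inl (.startF (hF'.congr (hN m hc).1.symm))) hc
    · intro hR' z v hv hz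
      -- A walk ending backward along the edge out of `m` would have moved that edge into `F'`.
      have he : Ends k F R m := by
        rw [h.ends_iff]
        intro hc
        exact h.not_both (hR'.congr (hW m (.inr hc)).2.symm) hc.redOut_bwd
      obtain ⟨x, y, hc, hx, hy⟩ := he
      rwa [h'.special_head_unique hv hy hz (hx.congr (hW x (.inl hc)).2)]
  refine ⟨key a, fun ha => ?_⟩
  -- So far the new walk is only known to lie inside the old one. This is why `reverse_of_crabwalk`
  -- lets other nodes be exchanged as well.
  have hW' : ∀ x, Crabwalk k F' R' m (.fwd x) ∨ Crabwalk k F' R' m (.bwd x) →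
      F x = R' x ∧ R x = F' x := fun x hc => by
    have e := hW x (hc.elim (fun hc => .inr (key _ hc)) fun hc => .inl (key _ hc))
    exact ⟨e.2.symm, e.1.symm⟩
  have := h'.reverse_of_crabwalk h (fun x => ?_) hW' ?_ ?_ ha
  · cases a <;> exact this
  · rcases hx x with e | e
    · exact .inl ⟨e.1.symm, e.2.symm⟩
    · exact .inr ⟨e.2.symm, e.1.symm⟩
  · intro hF
    by_contra hc
    obtain ⟨x, y, hc, hx, hy⟩ := h'.ends_iff.2 hc
    exact h.not_both hF (h.redOut_of_special_head hy (hx.congr (hW' x (.inl hc)).2))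
  · intro hR z v hv hz
    have he : Ends k F' R' m := by
      rw [h'.ends_iff]
      intro hc
      exact h.not_both (key _ hc).redOut_fwd hR
    obtain ⟨x, y, hc, hx, hy⟩ := he
    rwa [h.special_head_unique hv hy hz (hx.congr (hW' x (.inl hc)).2)]

end CrabPair

open ColoredGraph

/-! ### Successor of an edge, and the red permutation -/

section Tuples

variable {n k : ℕ} {ι κ : Type*} {T T' : ι → ColoredGraph n} {m : Fin (n + 1)} {e : ℤˣ}

/-- The edge `q` of the family `T` (index of its graph, tail of the edge) comes after the edge `p`
on a walk that stays in one graph at non-special nodes and may change graphs at special ones. -/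
def Follows (k : ℕ) (T : ι → ColoredGraph n) (p q : ι × Fin (n + 1)) : Prop :=
  (T p.1).Arc p.2 q.2 ∧ (T q.1).HasOut q.2 ∧ (k < (q.2 : ℕ) → q.1 = p.1)

/-- The edge `p` of the family `T` is red. -/
def IsRed (T : ι → ColoredGraph n) (p : ι × Fin (n + 1)) : Prop := (T p.1).RedOut p.2

/-- Every special node has an edge out of it in at most one of the graphs. -/
def UniqueOut (k : ℕ) (T : ι → ColoredGraph n) : Prop :=
  ∀ (x : Fin (n + 1)) (i j : ι), (x : ℕ) ≤ k → (T i).HasOut x → (T j).HasOut x → i = j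

/-- `σ` maps each red edge to the next one, which is red too, and fixes what is not a red edge. -/
structure IsRedPerm (k : ℕ) (T : ι → ColoredGraph n) (σ : Equiv.Perm (ι × Fin (n + 1))) : Prop where
  follows : ∀ p, IsRed T p → Follows k T p (σ p)
  isRed : ∀ p, IsRed T p → IsRed T (σ p)
  fixed : ∀ p, ¬ IsRed T p → σ p = p

lemma ColoredGraph.RedOut.hasOut {G : ColoredGraph n} {x : Fin (n + 1)} (h : G.RedOut x) :
    G.HasOut x := h.imp fun _ hy => ⟨_, hy⟩

lemma ColoredGraph.Arc.head_eq {G : ColoredGraph n} {x y y' : Fin (n + 1)} (h : G.Arc x y)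
    (h' : G.Arc x y') : y = y' := by
  obtain ⟨c, h⟩ := h
  obtain ⟨c', h'⟩ := h'
  rw [h] at h'
  simp only [Option.some.injEq, Prod.mk.injEq] at h'
  exact h'.1

lemma Follows.eq (hT : UniqueOut k T) {p q q' : ι × Fin (n + 1)} (h : Follows k T p q)
    (h' : Follows k T p q') : q = q' := by
  have h2 : q.2 = q'.2 := h.1.head_eq h'.1
  refine Prod.ext ?_ h2
  rcases le_or_gt (q.2 : ℕ) k with hk | hk
  · exact hT q.2 _ _ hk h.2.1 (h2 ▸ h'.2.1)
  · rw [h.2.2 hk, h'.2.2 (h2 ▸ hk)]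

namespace IsRedPerm

variable {σ : Equiv.Perm (ι × Fin (n + 1))}

lemma redArc (h : IsRedPerm k T σ) {p : ι × Fin (n + 1)} (hp : IsRed T p) :
    (T p.1).RedArc p.2 (σ p).2 := by
  obtain ⟨y, hy⟩ := hp
  have hy' : (T p.1).Arc p.2 y := ⟨_, hy⟩
  rwa [(h.follows p ⟨y, hy⟩).1.head_eq hy']

lemma isRed_symm (h : IsRedPerm k T σ) {p : ι × Fin (n + 1)} (hp : IsRed T p) :
    IsRed T (σ.symm p) := by
  by_contra hn
  have := h.fixed _ hn
  rw [Equiv.apply_symm_apply] at this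
  exact hn (this ▸ hp)

lemma redBalanced (h : IsRedPerm k T σ) (hT : UniqueOut k T) (i : ι) : (T i).RedBalanced k where
  out_iff y hy := by
    constructor
    · intro hr
      have hp := h.isRed_symm (p := (i, y)) hr
      have hf := h.follows _ hp
      have ha := h.redArc hp
      rw [Equiv.apply_symm_apply] at hf ha
      have hi : i = (σ.symm (i, y)).1 := hf.2.2 hy
      rw [← hi] at ha
      exact ⟨_, ha⟩
    · rintro ⟨x, hx⟩
      have hr : IsRed T (i, x) := hx.redOut
      have hf := h.follows _ hr
      have hxy : (σ (i, x)).2 = y := (h.redArc hr).head_eq hx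
      have hi : (σ (i, x)).1 = i := hf.2.2 (by rw [hxy]; exact hy)
      have := h.isRed _ hr
      rw [IsRed, hxy, hi] at this
      exact this
  inj x x' y hx hx' := by
    have hr : IsRed T (i, x) := hx.redOut
    have hr' : IsRed T (i, x') := hx'.redOut
    have hy : (σ (i, x)).2 = y := (h.redArc hr).head_eq hx
    have hy' : (σ (i, x')).2 = y := (h.redArc hr').head_eq hx'
    have hf' := h.follows _ hr'
    -- Edges of one graph with a common head have a common successor, so injectivity of `σ` applies,
    -- at special heads too.
    have : Follows k T (i, x) (σ (i, x')) := ⟨by rw [hy']; exact ⟨_, hx⟩, hf'.2⟩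
    have := σ.injective ((h.follows _ hr).eq hT this)
    exact congrArg Prod.snd this

end IsRedPerm

/-! ### The sign and its change under an exchange -/

section Sign

variable [Fintype ι] [DecidableEq ι] [Fintype κ] [DecidableEq κ]

open Classical in
/-- The red edges of `T` form (meta-)cycles, and `e` is `-1` to the power of their number. -/
def HasSign (k : ℕ) (T : ι → ColoredGraph n) (e : ℤˣ) : Prop :=
  ∃ σ : Equiv.Perm (ι × Fin (n + 1)), IsRedPerm k T σ ∧
    Equiv.Perm.sign σ * (-1) ^ (Finset.univ.filter (IsRed T)).card = e

open Classical in
/-- Only the red edges matter for `HasSign`. -/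
lemma HasSign.of_redArc (h : HasSign k T e)
    (hr : ∀ i x y, (T' i).RedArc x y ↔ (T i).RedArc x y) : HasSign k T' e := by
  obtain ⟨σ, hσ, he⟩ := h
  have hred : ∀ p, IsRed T' p ↔ IsRed T p := fun p => exists_congr fun y => hr _ _ _
  refine ⟨σ, ⟨fun p hp => ?_, fun p hp => ?_, fun p hp => ?_⟩, ?_⟩
  · rw [hred] at hp
    exact ⟨⟨_, (hr _ _ _).2 (hσ.redArc hp)⟩, ((hred _).2 (hσ.isRed p hp)).hasOut,
      (hσ.follows p hp).2.2⟩
  · rw [hred] at hp ⊢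
    exact hσ.isRed p hp
  · rw [hred] at hp
    exact hσ.fixed p hp
  · rw [← he]
    congr 3
    exact Finset.filter_congr fun p _ => hred p

lemma HasSign.reindex (f : κ ≃ ι) (h : HasSign k T e) : HasSign k (fun i => T (f i)) e := by
  obtain ⟨σ, hσ, he⟩ := h
  let g : κ × Fin (n + 1) ≃ ι × Fin (n + 1) := f.prodCongr (Equiv.refl _)
  have hs : ∀ p, g ((g.permCongr.symm σ) p) = σ (g p) := fun p => by
    simp
  have h2 : ∀ p, (g p).2 = p.2 := fun p => rfl
  have h1 : ∀ p, (g p).1 = f p.1 := fun p => rfl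
  refine ⟨g.permCongr.symm σ, ⟨fun p hp => ?_, fun p hp => ?_, fun p hp => ?_⟩, ?_⟩
  · have := hσ.follows (g p) hp
    rw [← hs] at this
    exact ⟨this.1, this.2.1, fun hk => f.injective (this.2.2 hk)⟩
  · have := hσ.isRed (g p) hp
    rw [← hs] at this
    exact this
  · have := hσ.fixed (g p) hp
    rw [← hs] at this
    exact g.injective this
  · rw [← he]
    congr 1
    · rw [Equiv.permCongr_symm, Equiv.Perm.sign_permCongr]
    · congr 1
      refine Finset.card_equiv g fun p => ?_
      simp only [Finset.mem_filter, Finset.mem_univ, true_and]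
      exact Iff.rfl

open Classical in
/-- Exchange the edges out of the nodes in `W` between the graphs `T f` and `T g`. -/
noncomputable def exchange (T : ι → ColoredGraph n) (f g : ι) (W : Set (Fin (n + 1))) :
    ι → ColoredGraph n :=
  fun i x => if x ∈ W then T (Equiv.swap f g i) x else T i x

/-- The nodes whose out-edges the crabwalk uses. -/
def usedNodes (k : ℕ) (F R : ColoredGraph n) (m : Fin (n + 1)) : Set (Fin (n + 1)) :=
  {x | Crabwalk k F R m (.fwd x) ∨ Crabwalk k F R m (.bwd x)}

open Classical in
/-- Exchanging the edges used by the crabwalk changes the sign if and only if the crabwalk begins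
backward and ends forward. -/
lemma HasSign.exchange {f g : ι} (hfg : f ≠ g)
    (h : CrabPair k (T f) (T g) m) (he : HasSign k T e) :
    HasSign k (exchange T f g (usedNodes k (T f) (T g) m))
      (if (T g).RedOut m ∧ CrabPair.Ends k (T f) (T g) m then -e else e) := by
  obtain ⟨σ, hσ, rfl⟩ := he
  set W := usedNodes k (T f) (T g) m with hW
  -- `a` sends each edge slot to the slot where its edge lies after the exchange. `c` corrects the
  -- successor where the tails of an edge and its successor were not treated alike.
  set a : Equiv.Perm (ι × Fin (n + 1)) :=
    Equiv.prodCongrLeft fun x => if x ∈ W then Equiv.swap f g else 1 with ha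
  set c : Equiv.Perm (ι × Fin (n + 1)) :=
    Equiv.prodCongrLeft fun x => if CrabPair.Turn k (T f) (T g) m x then Equiv.swap f g else 1
    with hc
  have haT : ∀ q, _root_.exchange T f g W (a q).1 (a q).2 = T q.1 q.2 := by
    rintro ⟨i, x⟩
    by_cases hx : x ∈ W <;> simp [ha, _root_.exchange, hx]
  have haR : ∀ q, IsRed (_root_.exchange T f g W) (a q) ↔ IsRed T q := fun q => by
    simp only [IsRed, RedOut, RedArc, haT]
  have hcR : ∀ q, IsRed T q → IsRed T (c q) := by
    rintro ⟨i, x⟩ hq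
    by_cases hx : CrabPair.Turn k (T f) (T g) m x
    · have := h.turn_redOut hx
      simp only [hc, Equiv.prodCongrLeft_apply, hx, if_true, IsRed]
      rw [Equiv.swap_apply_def]
      split_ifs
      · exact this.2
      · exact this.1
      · exact hq
    · simpa [hc, hx] using hq
  -- Turns are exactly the places where one of two consecutive edges is moved and the other is not.
  have hturn : ∀ q, IsRed T q → k < ((σ q).2 : ℕ) → (q.1 = f ∨ q.1 = g) →
      (CrabPair.Turn k (T f) (T g) m (σ q).2 ↔ ¬ (q.2 ∈ W ↔ (σ q).2 ∈ W)) := by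
    rintro ⟨i, x⟩ hq hk hi
    have harc := hσ.redArc hq
    have hi' := (hσ.follows _ hq).2.2 hk
    have hq' := hσ.isRed _ hq
    rw [IsRed, hi'] at hq'
    dsimp only at hi harc hq' ⊢
    rcases hi with rfl | rfl
    · rw [h.turn_iff_fwd hk harc, ← h.used_iff_fwd harc.redOut, ← h.used_iff_fwd hq']
      rfl
    · rw [h.turn_iff_bwd hk harc, ← h.used_iff_bwd harc.redOut, ← h.used_iff_bwd hq']
      rfl
  have happ : ∀ q, (a * c * σ * a⁻¹) (a q) = a (c (σ q)) := fun q => by simp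
  refine ⟨a * c * σ * a⁻¹, ⟨fun p => ?_, fun p => ?_, fun p => ?_⟩, ?_⟩
  · obtain ⟨q, rfl⟩ := a.surjective p
    intro hq
    rw [haR] at hq
    rw [happ]
    refine ⟨?_, RedOut.hasOut ((haR _).2 (hcR _ (hσ.isRed _ hq))), fun hk => ?_⟩
    · exact ⟨_, (haT q).trans (hσ.redArc hq)⟩
    · have hk' : k < ((σ q).2 : ℕ) := hk
      have hi := (hσ.follows _ hq).2.2 hk'
      change (if (σ q).2 ∈ W then Equiv.swap f g else 1)
        ((if CrabPair.Turn k (T f) (T g) m (σ q).2 then Equiv.swap f g else 1) (σ q).1) =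
        (if q.2 ∈ W then Equiv.swap f g else 1) q.1
      rw [hi]
      -- The swaps from `a` at the tail, `a` at the head and `c` at the head are even in number, so
      -- the new edges lie in one graph.
      by_cases hfi : q.1 = f ∨ q.1 = g
      · have ht := hturn q hq hk' hfi
        by_cases h1 : q.2 ∈ W <;> by_cases h2 : (σ q).2 ∈ W <;> simp [ht, h1, h2]
      · push Not at hfi
        have hsw : Equiv.swap f g q.1 = q.1 := Equiv.swap_apply_of_ne_of_ne hfi.1 hfi.2
        split_ifs <;> simp [hsw]
  · obtain ⟨q, rfl⟩ := a.surjective p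
    rw [happ, haR, haR]
    exact fun hq => hcR _ (hσ.isRed _ hq)
  · obtain ⟨q, rfl⟩ := a.surjective p
    rw [happ, haR]
    intro hq
    rw [hσ.fixed _ hq]
    congr 1
    obtain ⟨i, x⟩ := q
    by_cases hx : CrabPair.Turn k (T f) (T g) m x
    · have h12 := h.turn_redOut hx
      have hfi : i ≠ f ∧ i ≠ g :=
        ⟨fun h0 => hq (by subst h0; exact h12.1), fun h0 => hq (by subst h0; exact h12.2)⟩
      simp [hc, hx, Equiv.swap_apply_of_ne_of_ne hfi.1 hfi.2]
    · simp [hc, hx]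
  · have hcard : (Finset.univ.filter (IsRed (_root_.exchange T f g W))).card =
        (Finset.univ.filter (IsRed T)).card := by
      refine (Finset.card_equiv a fun q => ?_).symm
      simp only [Finset.mem_filter, Finset.mem_univ, true_and, haR]
    have hsign : Equiv.Perm.sign c =
        (-1) ^ (Finset.univ.filter (CrabPair.Turn k (T f) (T g) m)).card := by
      rw [hc, Equiv.Perm.sign_prodCongrLeft]
      simp only [apply_ite Equiv.Perm.sign, Equiv.Perm.sign_swap hfg, map_one, Finset.prod_ite,
        Finset.prod_const, one_pow, mul_one]
    have hs : Equiv.Perm.sign (a * c * σ * a⁻¹) = Equiv.Perm.sign c * Equiv.Perm.sign σ := by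
      simp only [map_mul, map_inv]
      rw [mul_assoc, mul_assoc, mul_comm, mul_assoc, mul_assoc, inv_mul_cancel, mul_one]
    rw [hs, hcard, hsign]
    split_ifs with ho
    · rw [((h.odd_card_turn_iff).2 ho).neg_one_pow]
      simp
    · rw [(Nat.not_odd_iff_even.1 (mt h.odd_card_turn_iff.1 ho)).neg_one_pow, one_mul]

end Sign

end Tuples

open ColoredGraph

/-! ### The pairwise map as an involution -/

section Pairs

variable {n k : ℕ} {F R : ColoredGraph n} {m x : Fin (n + 1)}

lemma ColoredGraph.HasOut.black_or_red {G : ColoredGraph n} (h : G.HasOut x) :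
    G.BlackOut x ∨ G.RedOut x := by
  obtain ⟨y, c, h⟩ := h
  cases c
  · exact .inl ⟨y, h⟩
  · exact .inr ⟨y, h⟩

lemma ColoredGraph.BlackOut.hasOut {G : ColoredGraph n} (h : G.BlackOut x) : G.HasOut x :=
  h.imp fun _ h => ⟨_, h⟩

lemma ColoredGraph.BlackOut.not_redOut {G : ColoredGraph n} (h : G.BlackOut x) : ¬ G.RedOut x := by
  rintro ⟨y, hy⟩
  obtain ⟨z, hz⟩ := h
  unfold RedArc at hy
  rw [hz] at hy
  simp at hy

lemma ColoredGraph.hasOut_congr {F G : ColoredGraph n} (h : F x = G x) : F.HasOut x ↔ G.HasOut x := by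
  simp only [HasOut, Arc, h]

/-- The conditions on the pair `(F, R)` under which `phiPair` is studied. -/
structure StepPair (k : ℕ) (F R : ColoredGraph n) (m : Fin (n + 1)) : Prop where
  first : IsFirstNode k F R m
  not_both : F.HasOut m → ¬ R.HasOut m
  special : ∀ x : Fin (n + 1), (x : ℕ) ≤ k → R.HasOut x → x = m
  balF : F.RedBalanced k
  balR : R.RedBalanced k

namespace StepPair

lemma crabPair (h : StepPair k F R m) (hr : F.RedOut m ∨ R.RedOut m) : CrabPair k F R m where
  balF := h.balF
  balR := h.balR
  le := h.first.1.2.1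
  red := hr
  not_both hF hR := h.not_both hF.hasOut hR.hasOut
  special x hx hR := h.special x hx hR.hasOut

lemma black_or_red (h : StepPair k F R m) :
    (F.BlackOut m ∨ R.BlackOut m) ∧ ¬ (F.RedOut m ∨ R.RedOut m) ∨
    ¬ (F.BlackOut m ∨ R.BlackOut m) ∧ (F.RedOut m ∨ R.RedOut m) := by
  have h1 := h.not_both
  rcases h.first.1.2.2 with hF | hR
  · rcases hF.black_or_red with hb | hr
    · exact .inl ⟨.inl hb, not_or.2 ⟨hb.not_redOut, fun h0 => h1 hF h0.hasOut⟩⟩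
    · exact .inr ⟨not_or.2 ⟨fun h0 => h0.not_redOut hr, fun h0 => h1 hF h0.hasOut⟩, .inl hr⟩
  · rcases hR.black_or_red with hb | hr
    · exact .inl ⟨.inr hb, not_or.2 ⟨fun h0 => h1 h0.hasOut hR, hb.not_redOut⟩⟩
    · exact .inr ⟨not_or.2 ⟨fun h0 => h1 h0.hasOut hR, fun h0 => h0.not_redOut hr⟩, .inr hr⟩

lemma movedNodes_red (h : StepPair k F R m) (hr : F.RedOut m ∨ R.RedOut m) :
    movedNodes k F R = usedNodes k F R m := by
  have hb : ¬ (F.BlackOut m ∨ R.BlackOut m) := by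
    have := h.black_or_red
    tauto
  ext x
  constructor
  · rintro ⟨m', hm', h0⟩
    obtain rfl := hm'.unique h.first
    exact (h0.resolve_left fun h1 => hb h1.1).2
  · exact fun hx => ⟨m, h.first, .inr ⟨hr, hx⟩⟩

lemma endsInF_red (h : StepPair k F R m) (hr : F.RedOut m ∨ R.RedOut m) :
    EndsInF k F R ↔ CrabPair.Ends k F R m := by
  constructor
  · rintro ⟨m', hm', -, h0⟩
    obtain rfl := hm'.unique h.first
    exact h0
  · exact fun hx => ⟨m, h.first, hr, hx⟩

lemma movedNodes_black (h : StepPair k F R m) (hr : ¬ (F.RedOut m ∨ R.RedOut m)) :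
    movedNodes k F R = {m} := by
  have hb : F.BlackOut m ∨ R.BlackOut m := by
    have := h.black_or_red
    tauto
  ext x
  constructor
  · rintro ⟨m', hm', h0⟩
    obtain rfl := hm'.unique h.first
    exact (h0.resolve_right fun h1 => hr h1.1).2
  · exact fun hx => ⟨m, h.first, .inl ⟨hb, hx⟩⟩

lemma not_endsInF_black (h : StepPair k F R m) (hr : ¬ (F.RedOut m ∨ R.RedOut m)) :
    ¬ EndsInF k F R := by
  rintro ⟨m', hm', h1, -⟩
  obtain rfl := hm'.unique h.first
  exact hr h1

lemma mem_movedNodes (h : StepPair k F R m) (hF : F.HasOut m) : m ∈ movedNodes k F R := by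
  by_cases hr : F.RedOut m ∨ R.RedOut m
  · rw [h.movedNodes_red hr]
    exact .inl (.startF (hr.resolve_right fun h0 => h.not_both hF h0.hasOut))
  · rw [h.movedNodes_black hr]
    rfl

/-- A backward-starting walk either ends along the edge out of `m`, moving it to `F`, or ends in `F`
and leaves it in `R`. This dichotomy separates going down from turning around. -/
lemma mem_movedNodes_iff (h : StepPair k F R m) (hR : R.HasOut m) :
    m ∈ movedNodes k F R ↔ ¬ EndsInF k F R := by
  by_cases hr : F.RedOut m ∨ R.RedOut m
  · have hc := h.crabPair hr
    have hr' := hr.resolve_left fun h0 => h.not_both h0.hasOut hR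
    rw [h.movedNodes_red hr, h.endsInF_red hr, hc.ends_iff, not_not, ← hc.used_iff_bwd hr']
    rfl
  · rw [h.movedNodes_black hr]
    exact iff_of_true rfl (h.not_endsInF_black hr)

lemma eq_of_mem_movedNodes (h : StepPair k F R m) (hx : (x : ℕ) ≤ k)
    (hm : x ∈ movedNodes k F R) : x = m := by
  by_cases hr : F.RedOut m ∨ R.RedOut m
  · rw [h.movedNodes_red hr] at hm
    exact hm.elim (fun hc => hc.eq_of_fwd_special hx) fun hc =>
      h.special x hx hc.redOut_bwd.hasOut
  · rw [h.movedNodes_black hr] at hm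
    exact hm

lemma movedNodes_phiPair (h : StepPair k F R m)
    (h' : StepPair k (phiPair k F R).1 (phiPair k F R).2 m) :
    movedNodes k (phiPair k F R).1 (phiPair k F R).2 = movedNodes k F R := by
  have hW : ∀ x, x ∈ movedNodes k F R → (phiPair k F R).1 x = R x ∧ (phiPair k F R).2 x = F x :=
    fun x hx => ⟨if_pos hx, if_pos hx⟩
  have hN : ∀ x, x ∉ movedNodes k F R → (phiPair k F R).1 x = F x ∧ (phiPair k F R).2 x = R x :=
    fun x hx => ⟨if_neg hx, if_neg hx⟩
  have hrr : ((phiPair k F R).1.RedOut m ∨ (phiPair k F R).2.RedOut m) ↔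
      (F.RedOut m ∨ R.RedOut m) := by
    by_cases hm : m ∈ movedNodes k F R
    · simp only [RedOut, RedArc, hW m hm]
      exact or_comm
    · simp only [RedOut, RedArc, hN m hm]
  by_cases hr : F.RedOut m ∨ R.RedOut m
  · have hr' := hrr.2 hr
    rw [h.movedNodes_red hr] at hW hN
    have hc := (h.crabPair hr).crabwalk_exchange (h'.crabPair hr') hW hN
    rw [h'.movedNodes_red hr', h.movedNodes_red hr]
    ext x
    exact (or_congr (hc _) (hc _)).trans or_comm
  · rw [h'.movedNodes_black (mt hrr.1 hr), h.movedNodes_black hr]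

lemma phiPair_phiPair (h : StepPair k F R m)
    (h' : StepPair k (phiPair k F R).1 (phiPair k F R).2 m) :
    phiPair k (phiPair k F R).1 (phiPair k F R).2 = (F, R) := by
  conv_lhs => rw [phiPair]
  rw [h.movedNodes_phiPair h']
  refine Prod.ext (funext fun x => ?_) (funext fun x => ?_)
  · by_cases hx : x ∈ movedNodes k F R <;> simp [phiPair, hx]
  · by_cases hx : x ∈ movedNodes k F R <;> simp [phiPair, hx]

variable {ι : Type*} [Fintype ι] [DecidableEq ι]

open Classical in
-- In the black case no red edge leaves `m` in either graph, so the exchange leaves all red edges in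
-- place.
lemma hasSign_exchange {T : ι → ColoredGraph n} {f g : ι} (hfg : f ≠ g)
    (h : StepPair k (T f) (T g) m) {e : ℤˣ} (he : HasSign k T e) :
    HasSign k (exchange T f g (movedNodes k (T f) (T g)))
      (if (T g).HasOut m ∧ EndsInF k (T f) (T g) then -e else e) := by
  by_cases hr : (T f).RedOut m ∨ (T g).RedOut m
  · have := he.exchange hfg (h.crabPair hr)
    rw [h.movedNodes_red hr, h.endsInF_red hr]
    have hiff : (T g).HasOut m ↔ (T g).RedOut m := by
      refine ⟨fun h0 => hr.resolve_left fun h1 => h.not_both h1.hasOut h0, RedOut.hasOut⟩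
    rwa [if_congr (and_congr_left' hiff) rfl rfl]
  · rw [if_neg fun h0 => h.not_endsInF_black hr h0.2, h.movedNodes_black hr]
    refine he.of_redArc fun i x y => ?_
    by_cases hx : x = m
    · subst hx
      simp only [RedArc, exchange, Set.mem_singleton_iff, if_true]
      push Not at hr
      have hf : ∀ y, T f x ≠ some (y, EdgeColor.red) := fun y h0 => hr.1 ⟨y, h0⟩
      have hg : ∀ y, T g x ≠ some (y, EdgeColor.red) := fun y h0 => hr.2 ⟨y, h0⟩
      rw [Equiv.swap_apply_def]
      split_ifs with h1 h2
      · subst h1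
        exact iff_of_false (hg y) (hf y)
      · subst h2
        exact iff_of_false (hf y) (hg y)
      · rfl
    · simp [RedArc, exchange, hx]

end StepPair

end Pairs

/-! ### Steps between levels -/

section Levels

variable {n r i : ℕ} {Γ : Digraph (Fin (n + 1))} {e : ℤˣ} {s : PiTau n r}

/-- All graphs of a state, `none` standing for `π`. -/
def PiTau.toTuple (s : PiTau n r) : Option (Fin r) → ColoredGraph n
  | none => s.1
  | some j => s.2 j

lemma toTuple_phiStep (s : PiTau n r) (j : Fin r) :
    (phiStep s j).toTuple =
      exchange s.toTuple none (some j) (movedNodes (r + 1) s.1 (s.2 j)) := by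
  funext l x
  rcases l with _ | l
  · simp [PiTau.toTuple, phiStep, exchange, phiPair]
  · by_cases hl : l = j
    · subst hl
      simp [PiTau.toTuple, phiStep, exchange, phiPair]
    · have hsw : Equiv.swap none (some j) (some l) = some l :=
        Equiv.swap_apply_of_ne_of_ne (by simp) (by simpa using hl)
      simp [PiTau.toTuple, phiStep, exchange, hl, hsw]

/-- The states reached after `i` of the maps `φ₁¹, φ₁², …` have been applied to an element of `S₁`:
the edges out of the nodes `1, …, i` are in `τ₁, …, τᵢ` and the edges out of `i + 1, …, k` in `π`;
`e` is the sign. -/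
structure Level (Γ : Digraph (Fin (n + 1))) (i : ℕ) (e : ℤˣ) (s : PiTau n r) : Prop where
  le : i ≤ r
  adj : ∀ l x y, (s.toTuple l).Arc x y → Γ.Adj x y
  out_pi : ∀ x : Fin (n + 1), s.1.HasOut x ↔ i < (x : ℕ)
  out_tau : ∀ (j : Fin r) (x : Fin (n + 1)),
    (s.2 j).HasOut x ↔ r + 1 < (x : ℕ) ∨ ((x : ℕ) = j + 1 ∧ (j : ℕ) < i)
  sign : HasSign (r + 1) s.toTuple e

namespace Level

lemma uniqueOut (h : Level Γ i e s) : UniqueOut (r + 1) s.toTuple := by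
  rintro x (_ | j) (_ | l) hx h1 h2
  · rfl
  · have h1 := (h.out_pi x).1 h1
    have h2 := (h.out_tau l x).1 h2
    omega
  · have h1 := (h.out_tau j x).1 h1
    have h2 := (h.out_pi x).1 h2
    omega
  · have h1 := (h.out_tau j x).1 h1
    have h2 := (h.out_tau l x).1 h2
    congr 1
    ext
    omega

lemma redBalanced (h : Level Γ i e s) (l : Option (Fin r)) :
    (s.toTuple l).RedBalanced (r + 1) := by
  obtain ⟨σ, hσ, -⟩ := h.sign
  exact hσ.redBalanced h.uniqueOut l

variable {j : Fin r} {m : Fin (n + 1)}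

/-- The first node is `j + 1` at both levels `j` and `j + 1`; hence applying the step twice treats
the same `m`. -/
lemma stepPair (h : Level Γ i e s) (hij : i = j ∨ i = j + 1) (hm : (m : ℕ) = j + 1) :
    StepPair (r + 1) s.1 (s.2 j) m where
  first := by
    refine ⟨⟨by omega, by omega, ?_⟩, ?_⟩
    · rw [h.out_pi, h.out_tau]
      omega
    · rintro x ⟨h1, h2, h3⟩
      rw [h.out_pi, h.out_tau] at h3
      rw [Fin.le_def]
      omega
  not_both h1 h2 := by
    rw [h.out_pi] at h1
    rw [h.out_tau] at h2
    omega
  special x hx h1 := by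
    rw [h.out_tau] at h1
    ext
    omega
  balF := h.redBalanced none
  balR := h.redBalanced (some j)

open Classical in
/-- The general form of one step of `φ₁`. -/
lemma phiStep_of_movedNodes (h : Level Γ i e s) (hij : i = j ∨ i = j + 1)
    (hm : (m : ℕ) = j + 1) {i' : ℕ} {e' : ℤˣ}
    (hi' : i' = if m ∈ movedNodes (r + 1) s.1 (s.2 j) then 2 * j + 1 - i else i)
    (he' : e' = if (s.2 j).HasOut m ∧ EndsInF (r + 1) s.1 (s.2 j) then -e else e) :
    Level Γ i' e' (phiStep s j) ∧ phiStep (phiStep s j) j = s ∧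
      movedNodes (r + 1) (phiStep s j).1 ((phiStep s j).2 j) =
        movedNodes (r + 1) s.1 (s.2 j) := by
  have hs := h.stepPair hij hm
  have hj := j.isLt
  have htt := toTuple_phiStep s j
  have h2j : (phiStep s j).2 j = (phiPair (r + 1) s.1 (s.2 j)).2 := Function.update_self ..
  -- The map `i ↦ 2 * j + 1 - i` interchanges the levels `j` and `j + 1`.
  have hl : i' = j ∨ i' = j + 1 := by
    rw [hi']
    split_ifs <;> omega
  have hlevel : Level Γ i' e' (phiStep s j) := by
    refine ⟨by omega, fun l x y hxy => ?_, fun x => ?_, fun l x => ?_, ?_⟩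
    · rw [htt] at hxy
      by_cases hx : x ∈ movedNodes (r + 1) s.1 (s.2 j)
      · simp only [Arc, exchange, hx, if_true] at hxy
        exact h.adj _ _ _ hxy
      · simp only [Arc, exchange, hx, if_false] at hxy
        exact h.adj _ _ _ hxy
    · by_cases hx : x ∈ movedNodes (r + 1) s.1 (s.2 j)
      · have e1 : (phiStep s j).1 x = s.2 j x := if_pos hx
        rw [hasOut_congr e1, h.out_tau]
        rcases le_or_gt (x : ℕ) (r + 1) with hxr | hxr
        · obtain rfl := hs.eq_of_mem_movedNodes hxr hx
          rw [if_pos hx] at hi'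
          omega
        · omega
      · have e1 : (phiStep s j).1 x = s.1 x := if_neg hx
        rw [hasOut_congr e1, h.out_pi]
        by_cases hxm : x = m
        · subst hxm
          rw [if_neg hx] at hi'
          omega
        · have : (x : ℕ) ≠ m := fun h0 => hxm (Fin.ext h0)
          have := h.le
          omega
    · by_cases hlj : l = j
      · subst hlj
        by_cases hx : x ∈ movedNodes (r + 1) s.1 (s.2 l)
        · have e1 : (phiStep s l).2 l x = s.1 x := by rw [h2j]; exact if_pos hx
          rw [hasOut_congr e1, h.out_pi]
          rcases le_or_gt (x : ℕ) (r + 1) with hxr | hxr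
          · obtain rfl := hs.eq_of_mem_movedNodes hxr hx
            rw [if_pos hx] at hi'
            omega
          · omega
        · have e1 : (phiStep s l).2 l x = s.2 l x := by rw [h2j]; exact if_neg hx
          rw [hasOut_congr e1, h.out_tau]
          by_cases hxm : x = m
          · subst hxm
            rw [if_neg hx] at hi'
            omega
          · have : (x : ℕ) ≠ m := fun h0 => hxm (Fin.ext h0)
            omega
      · have e1 : (phiStep s j).2 l = s.2 l := Function.update_of_ne hlj ..
        have : (l : ℕ) ≠ j := fun h0 => hlj (Fin.ext h0)
        rw [e1, h.out_tau]
        omega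
    · rw [htt, he']
      exact StepPair.hasSign_exchange (T := s.toTuple) (f := none) (g := some j) (by simp) hs h.sign
  have hs' := hlevel.stepPair hl hm
  rw [h2j] at hs'
  refine ⟨hlevel, ?_, ?_⟩
  · have hpp := hs.phiPair_phiPair hs'
    refine Prod.ext ?_ ?_
    · change (phiPair (r + 1) (phiPair (r + 1) s.1 (s.2 j)).1 ((phiStep s j).2 j)).1 = s.1
      rw [h2j, hpp]
    · change Function.update (phiStep s j).2 j
        (phiPair (r + 1) (phiPair (r + 1) s.1 (s.2 j)).1 ((phiStep s j).2 j)).2 = s.2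
      rw [h2j, hpp]
      simp [phiStep]
  · rw [h2j]
    exact hs.movedNodes_phiPair hs'

/-- The edge out of `j + 1` lies in `π` and is always moved. Since the same nodes move on the way
back, the inverse step cannot end in `π`, so a later descent does not stop here. -/
lemma step_up (hn : r + 1 ≤ n) (h : Level Γ j e s) :
    Level Γ (j + 1) e (phiStep s j) ∧ phiStep (phiStep s j) j = s ∧
      ¬ EndsInF (r + 1) (phiStep s j).1 ((phiStep s j).2 j) := by
  obtain ⟨m, hm⟩ : ∃ m : Fin (n + 1), (m : ℕ) = j + 1 := ⟨⟨j + 1, by omega⟩, rfl⟩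
  have hs := h.stepPair (.inl rfl) hm
  have hmm := hs.mem_movedNodes ((h.out_pi m).2 (by omega))
  obtain ⟨h1, h2, h3⟩ := h.phiStep_of_movedNodes (.inl rfl) hm (i' := j + 1) (e' := e)
    (by rw [if_pos hmm]; omega) (by rw [if_neg]; rintro ⟨h0, -⟩; rw [h.out_tau] at h0; omega)
  refine ⟨h1, h2, ?_⟩
  rw [← (h1.stepPair (.inr rfl) hm).mem_movedNodes_iff ((h1.out_tau j m).2 (by omega)), h3]
  exact hmm

lemma step_down (hn : r + 1 ≤ n) (h : Level Γ (j + 1) e s)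
    (hE : ¬ EndsInF (r + 1) s.1 (s.2 j)) :
    Level Γ j e (phiStep s j) ∧ phiStep (phiStep s j) j = s := by
  obtain ⟨m, hm⟩ : ∃ m : Fin (n + 1), (m : ℕ) = j + 1 := ⟨⟨j + 1, by omega⟩, rfl⟩
  have hs := h.stepPair (.inr rfl) hm
  have hmm := (hs.mem_movedNodes_iff ((h.out_tau j m).2 (by omega))).2 hE
  obtain ⟨h1, h2, -⟩ := h.phiStep_of_movedNodes (.inr rfl) hm (i' := j) (e' := e)
    (by rw [if_pos hmm]; omega) (by rw [if_neg fun h0 => hE h0.2])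
  exact ⟨h1, h2⟩

/-- The edge out of `j + 1` stays in `τ`. The repeated step again leaves it there, so a later
descent turns at the same place. -/
lemma step_turn (hn : r + 1 ≤ n) (h : Level Γ (j + 1) e s)
    (hE : EndsInF (r + 1) s.1 (s.2 j)) :
    Level Γ (j + 1) (-e) (phiStep s j) ∧ phiStep (phiStep s j) j = s ∧
      EndsInF (r + 1) (phiStep s j).1 ((phiStep s j).2 j) := by
  obtain ⟨m, hm⟩ : ∃ m : Fin (n + 1), (m : ℕ) = j + 1 := ⟨⟨j + 1, by omega⟩, rfl⟩
  have hs := h.stepPair (.inr rfl) hm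
  have hmm := mt (hs.mem_movedNodes_iff ((h.out_tau j m).2 (by omega))).1 (not_not.2 hE)
  obtain ⟨h1, h2, h3⟩ := h.phiStep_of_movedNodes (.inr rfl) hm (i' := j + 1) (e' := -e)
    (by rw [if_neg hmm]) (by rw [if_pos ⟨(h.out_tau j m).2 (by omega), hE⟩])
  refine ⟨h1, h2, ?_⟩
  by_contra h0
  rw [← h3] at hmm
  exact hmm ((((h1.stepPair (.inr rfl) hm).mem_movedNodes_iff
    ((h1.out_tau j m).2 (by omega)))).2 h0)

end Level

end Levels

open ColoredGraph

/-! ### Whole runs and their reversal -/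

section Runs

variable {n r i : ℕ} {Γ : Digraph (Fin (n + 1))} {e : ℤˣ} {s : PiTau n r}

lemma phiSteps_cons (s : PiTau n r) (j : Fin r) (l : List (Fin r)) :
    phiSteps s (j :: l) = phiSteps (phiStep s j) l := rfl

lemma phiSteps_append (s : PiTau n r) (l l' : List (Fin r)) :
    phiSteps s (l ++ l') = phiSteps (phiSteps s l) l' := List.foldl_append ..

lemma drop_finRange (hi : i < r) :
    (List.finRange r).drop i = ⟨i, hi⟩ :: (List.finRange r).drop (i + 1) := by
  rw [List.drop_eq_getElem_cons (by simpa using hi)]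
  simp

lemma take_finRange (hi : i < r) :
    (List.finRange r).take (i + 1) = (List.finRange r).take i ++ [⟨i, hi⟩] := by
  rw [← List.take_append_getElem (by simpa using hi)]
  simp

lemma filter_finRange (j : Fin r) :
    (List.finRange r).filter (fun i => j < i) = (List.finRange r).drop (j + 1) := by
  conv_lhs => rw [← List.take_append_drop (j + 1) (List.finRange r), List.filter_append]
  rw [List.filter_eq_nil_iff.2, List.filter_eq_self.2, List.nil_append]
  · intro a ha
    obtain ⟨l, hl, rfl⟩ := List.mem_drop_iff_getElem.1 ha
    simp only [List.getElem_finRange, decide_eq_true_eq, Fin.lt_def]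
    simp
    omega
  · intro a ha
    obtain ⟨l, hl, rfl⟩ := List.mem_take_iff_getElem.1 ha
    simp only [List.getElem_finRange, decide_eq_true_eq, Fin.lt_def]
    simp
    omega

namespace Level

/-- A descent undoes a climb step by step; `l` is what remains of the descent below the level where
the climb began. -/
lemma phiSteps_up (hn : r + 1 ≤ n) (h : Level Γ i e s) :
    Level Γ r e (phiSteps s ((List.finRange r).drop i)) ∧ ∀ l,
      phiUntil (phiSteps s ((List.finRange r).drop i)) (((List.finRange r).drop i).reverse ++ l) =
        phiUntil s l := by
  obtain ⟨d, hd⟩ := Nat.exists_eq_add_of_le h.le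
  induction d generalizing i s with
  | zero =>
    obtain rfl : i = r := by omega
    rw [List.drop_eq_nil_of_le (by simp)]
    exact ⟨h, fun l => rfl⟩
  | succ d ih =>
    have hi : i < r := by omega
    obtain ⟨h1, h2, h3⟩ := Level.step_up (j := ⟨i, hi⟩) hn h
    obtain ⟨h4, h5⟩ := ih (i := i + 1) h1 (by omega)
    rw [drop_finRange hi, phiSteps_cons]
    refine ⟨h4, fun l => ?_⟩
    rw [List.reverse_cons, List.append_assoc, h5, List.singleton_append, phiUntil, if_neg h3, h2]

/-- The last clause of each alternative says how to recover `s`: climb back, after undoing the turn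
if there was one. -/
lemma phiUntil_down (hn : r + 1 ≤ n) (h : Level Γ i e s) :
    (∃ s', phiUntil s ((List.finRange r).take i).reverse = (s', none) ∧ Level Γ 0 e s' ∧
      phiSteps s' ((List.finRange r).take i) = s) ∨
    ∃ (j : Fin r) (s' : PiTau n r), phiUntil s ((List.finRange r).take i).reverse = (s', some j) ∧
      (j : ℕ) < i ∧ Level Γ (j + 1) (-e) s' ∧ EndsInF (r + 1) s'.1 (s'.2 j) ∧
      phiSteps (phiStep s' j) (((List.finRange r).take i).drop (j + 1)) = s := by
  induction i generalizing s with
  | zero => exact .inl ⟨s, by simp [phiUntil], h, by simp [phiSteps]⟩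
  | succ i ih =>
    have hi : i < r := h.le
    have hlen : ((List.finRange r).take i).length = i := by simp; omega
    rw [take_finRange hi, List.reverse_append, List.reverse_singleton, List.singleton_append,
      phiUntil]
    by_cases hE : EndsInF (r + 1) s.1 (s.2 ⟨i, hi⟩)
    · obtain ⟨h1, h2, h3⟩ := Level.step_turn (j := ⟨i, hi⟩) hn h hE
      rw [if_pos hE]
      refine .inr ⟨⟨i, hi⟩, _, rfl, Nat.lt_succ_self i, h1, h3, ?_⟩
      rw [List.drop_eq_nil_of_le (by simp), h2]
      rfl
    · obtain ⟨h1, h2⟩ := Level.step_down (j := ⟨i, hi⟩) hn h hE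
      rw [if_neg hE]
      rcases ih h1 with ⟨s', h3, h4, h5⟩ | ⟨j, s', h3, h4, h5, h6, h7⟩
      · refine .inl ⟨s', h3, h4, ?_⟩
        rw [phiSteps_append, h5]
        exact h2
      · refine .inr ⟨j, s', h3, by omega, h5, h6, ?_⟩
        rw [List.drop_append_of_le_length (by omega), phiSteps_append, h7]
        exact h2

end Level

/-- The state of a tuple of the `S₁` kind or of the `S₂` kind is at the first or last level; the
sign is that in the signed set `S₁ - S₂`. -/
def DifferenceLevel (Γ : Digraph (Fin (n + 1))) (e : ℤˣ) :
    GraphTuple n (r + 1) ⊕ GraphTuple n (r + 1) → Prop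
  | .inl T => Level Γ 0 e (T 0, Fin.tail T)
  | .inr T => Level Γ r (-e) (T (Fin.last r), Fin.init T)

lemma phi₁_inl (T : GraphTuple n (r + 1)) :
    phi₁ (.inl T) = .inr (Fin.snoc (α := fun _ => ColoredGraph n)
      (phiSteps (T 0, Fin.tail T) (List.finRange r)).2
      (phiSteps (T 0, Fin.tail T) (List.finRange r)).1) := rfl

lemma phi₁_inr_none {T : GraphTuple n (r + 1)}
    (h : phiUntil (T (Fin.last r), Fin.init T) (List.finRange r).reverse = (s, none)) :
    phi₁ (.inr T) = .inl (Fin.cons (α := fun _ => ColoredGraph n) s.1 s.2) := by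
  rw [phi₁, h]

lemma phi₁_inr_some {T : GraphTuple n (r + 1)} {j : Fin r}
    (h : phiUntil (T (Fin.last r), Fin.init T) (List.finRange r).reverse = (s, some j)) :
    phi₁ (.inr T) = .inr (Fin.snoc (α := fun _ => ColoredGraph n)
      (phiSteps s ((List.finRange r).drop (j + 1))).2
      (phiSteps s ((List.finRange r).drop (j + 1))).1) := by
  rw [phi₁, h]
  simp only [filter_finRange]

theorem DifferenceLevel.phi₁ (hn : r + 1 ≤ n) {x : GraphTuple n (r + 1) ⊕ GraphTuple n (r + 1)}
    (hx : DifferenceLevel Γ e x) : DifferenceLevel Γ (-e) (phi₁ x) ∧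
      _root_.phi₁ (_root_.phi₁ x) = x := by
  have htake : (List.finRange r).take r = List.finRange r := List.take_of_length_le (by simp)
  have hsnoc : ∀ s : PiTau n r, ((Fin.snoc (α := fun _ => ColoredGraph n) s.2 s.1 :
      GraphTuple n (r + 1)) (Fin.last r), Fin.init (Fin.snoc (α := fun _ => ColoredGraph n)
        s.2 s.1 : GraphTuple n (r + 1))) = s := fun s => by
    simp
  rcases x with T | T
  · have hT : Level Γ 0 e (T 0, Fin.tail T) := hx
    obtain ⟨h1, h2⟩ := hT.phiSteps_up hn
    rw [List.drop_zero] at h1 h2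
    rw [phi₁_inl]
    refine ⟨?_, ?_⟩
    · rw [DifferenceLevel, hsnoc, neg_neg]
      exact h1
    · have h3 := h2 []
      rw [List.append_nil] at h3
      rw [phi₁_inr_none (s := (T 0, Fin.tail T)) (by rw [hsnoc, h3]; rfl)]
      exact congrArg Sum.inl (Fin.cons_self_tail T)
  · have hT : Level Γ r (-e) (T (Fin.last r), Fin.init T) := hx
    rcases hT.phiUntil_down hn with ⟨s, h1, h2, h3⟩ | ⟨j, s, h1, -, h3, h4, h5⟩
    · rw [htake] at h1 h3
      rw [phi₁_inr_none h1]
      refine ⟨by simpa [DifferenceLevel] using h2, ?_⟩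
      rw [phi₁_inl]
      simp only [Fin.cons_zero, Fin.tail_cons, h3, Fin.snoc_init_self]
    · rw [htake] at h1 h5
      rw [phi₁_inr_some h1]
      obtain ⟨h6, h7⟩ := h3.phiSteps_up hn
      refine ⟨?_, ?_⟩
      · rw [DifferenceLevel, hsnoc]
        exact h6
      · have h8 := h7 ((List.finRange r).take (j + 1)).reverse
        rw [← List.reverse_append, List.take_append_drop] at h8
        -- The second descent reaches the state just after the first turn. It turns there again, and
        -- the repeated step restores the state before that turn.
        have h9 : phiUntil s ((List.finRange r).take (j + 1)).reverse =
            (phiStep s j, some j) := by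
          rw [take_finRange j.isLt, List.reverse_append, List.reverse_singleton,
            List.singleton_append, phiUntil, if_pos h4]
        rw [phi₁_inr_some (s := phiStep s j) (j := j) (by rw [hsnoc, h8, h9]), h5]
        exact congrArg Sum.inr (Fin.snoc_init_self T)

end Runs

open ColoredGraph

/-! ### Sign of a permutation and number of orbits -/

section Orbits

variable {α : Type*} [Fintype α] [DecidableEq α]

open Classical in
/-- The sign of a permutation in terms of the number of its orbits on a set that contains its
support. -/
lemma Equiv.Perm.neg_one_pow_card_orbits (σ : Equiv.Perm α) (X : Finset α)
    (hX : ∀ p, p ∉ X → σ p = p) :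
    (-1 : ℤˣ) ^ (X.image fun p => Finset.univ.filter (σ.SameCycle p)).card =
      Equiv.Perm.sign σ * (-1) ^ X.card := by
  have hsub : σ.support ⊆ X := fun p hp => by
    by_contra h
    exact Equiv.Perm.mem_support.1 hp (hX p h)
  -- Orbits inside the support correspond to cycle factors; the rest of `X` gives one-point orbits,
  -- counted in `h2`.
  have h1 : (σ.support.image fun p => Finset.univ.filter (σ.SameCycle p)).card =
      σ.cycleFactorsFinset.card := by
    symm
    refine Finset.card_bij (fun c _ => c.support) (fun c hc => ?_) (fun c hc c' hc' he => ?_) ?_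
    · obtain ⟨a, ha⟩ := Equiv.Perm.IsCycle.nonempty_support
        (Equiv.Perm.mem_cycleFactorsFinset_iff.1 hc).1
      refine Finset.mem_image.2 ⟨a, Equiv.Perm.mem_cycleFactorsFinset_support_le hc ha, ?_⟩
      ext y
      have ha' := Equiv.Perm.mem_cycleFactorsFinset_support_le hc ha
      rw [Equiv.Perm.cycle_is_cycleOf ha hc, Equiv.Perm.mem_support_cycleOf_iff]
      simp [Equiv.Perm.mem_support.1 ha']
    · obtain ⟨a, ha⟩ := Equiv.Perm.IsCycle.nonempty_support
        (Equiv.Perm.mem_cycleFactorsFinset_iff.1 hc).1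
      have ha' : a ∈ c'.support := he ▸ ha
      rw [Equiv.Perm.cycle_is_cycleOf ha hc, Equiv.Perm.cycle_is_cycleOf ha' hc']
    · intro C hC
      obtain ⟨a, ha, rfl⟩ := Finset.mem_image.1 hC
      refine ⟨σ.cycleOf a, Equiv.Perm.cycleOf_mem_cycleFactorsFinset_iff.2 ha, ?_⟩
      ext y
      rw [Equiv.Perm.mem_support_cycleOf_iff]
      simp [Equiv.Perm.mem_support.1 ha]
  have hfix : ∀ p, σ p = p → ∀ q, σ.SameCycle p q ↔ q = p := fun p hp q => by
    constructor
    · rintro ⟨i, rfl⟩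
      exact Function.IsFixedPt.perm_zpow hp i
    · rintro rfl
      exact Equiv.Perm.SameCycle.refl _ _
  have h2 : ((X \ σ.support).image fun p => Finset.univ.filter (σ.SameCycle p)).card =
      (X \ σ.support).card := by
    refine Finset.card_image_of_injOn fun p hp q hq he => ?_
    have hp' := Equiv.Perm.notMem_support.1 (Finset.mem_sdiff.1 hp).2
    have : q ∈ Finset.univ.filter (σ.SameCycle q) := by
      simp [Equiv.Perm.SameCycle.refl]
    have he' : Finset.univ.filter (σ.SameCycle p) = Finset.univ.filter (σ.SameCycle q) := he
    rw [← he'] at this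
    exact ((hfix p hp' q).1 (by simpa using this)).symm
  have h3 : _root_.Disjoint (σ.support.image fun p => Finset.univ.filter (σ.SameCycle p))
      ((X \ σ.support).image fun p => Finset.univ.filter (σ.SameCycle p)) := by
    rw [Finset.disjoint_left]
    intro C hC hC'
    obtain ⟨p, hp, rfl⟩ := Finset.mem_image.1 hC
    obtain ⟨q, hq, he⟩ := Finset.mem_image.1 hC'
    have hq' := Equiv.Perm.notMem_support.1 (Finset.mem_sdiff.1 hq).2
    have : p ∈ Finset.univ.filter (σ.SameCycle p) := by
      simp [Equiv.Perm.SameCycle.refl]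
    rw [← he] at this
    have hpq := (hfix q hq' p).1 (by simpa using this)
    rw [hpq] at hp
    exact (Finset.mem_sdiff.1 hq).2 hp
  have h4 : (X.image fun p => Finset.univ.filter (σ.SameCycle p)).card =
      σ.cycleFactorsFinset.card + (X \ σ.support).card := by
    rw [← h1, ← h2, ← Finset.card_union_of_disjoint h3, ← Finset.image_union,
      Finset.union_sdiff_of_subset hsub]
  have h5 : X.card = (X \ σ.support).card + σ.support.card :=
    (Finset.card_sdiff_add_card_eq_card hsub).symm
  have h6 : Multiset.card σ.cycleType = σ.cycleFactorsFinset.card := by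
    rw [Equiv.Perm.cycleType_def, Multiset.card_map]
    rfl
  rw [Equiv.Perm.sign_of_cycleType, Equiv.Perm.sum_cycleType, h6, h4, h5, ← pow_add]
  rw [show σ.support.card + σ.cycleFactorsFinset.card +
    ((X \ σ.support).card + σ.support.card) = σ.cycleFactorsFinset.card + (X \ σ.support).card +
      2 * σ.support.card by ring, pow_add _ (_ + _) (2 * _), pow_mul]
  simp

end Orbits

/-! ### Cycles of the successor relation -/

section FollowCycles

variable {n k : ℕ} {ι : Type*} {T : ι → ColoredGraph n}

open Relation

/-- `C` is the set of edges of a cycle of the relation `Follows`. -/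
def IsFollowCycle (k : ℕ) (T : ι → ColoredGraph n) (C : Finset (ι × Fin (n + 1))) : Prop :=
  ∃ p, TransGen (Follows k T) p p ∧ ∀ q, q ∈ C ↔ ReflTransGen (Follows k T) p q

/-- Successors are unique, so a walk that leaves a point of a cycle cannot leave the cycle. -/
lemma UniqueOut.return (hT : UniqueOut k T) {p q : ι × Fin (n + 1)}
    (hp : TransGen (Follows k T) p p) (hq : ReflTransGen (Follows k T) p q) :
    ReflTransGen (Follows k T) q p := by
  induction hq with
  | refl => exact .refl
  | @tail b c _ hbc ih =>
    have : TransGen (Follows k T) b p := by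
      rcases reflTransGen_iff_eq_or_transGen.1 ih with rfl | h
      · exact hp
      · exact h
    obtain ⟨x, hx, hxp⟩ := TransGen.head'_iff.1 this
    rwa [hbc.eq hT hx]

namespace IsFollowCycle

variable {C C' : Finset (ι × Fin (n + 1))} {p q : ι × Fin (n + 1)}

lemma mem_iff (hC : IsFollowCycle k T C) (hT : UniqueOut k T) (hp : p ∈ C) :
    q ∈ C ↔ ReflTransGen (Follows k T) p q := by
  obtain ⟨p₀, h1, h2⟩ := hC
  rw [h2] at hp ⊢
  exact ⟨fun hq => (hT.return h1 hp).trans hq, fun hq => hp.trans hq⟩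

lemma nonempty (hC : IsFollowCycle k T C) : C.Nonempty := by
  obtain ⟨p, -, h⟩ := hC
  exact ⟨p, (h p).2 .refl⟩

lemma transGen (hC : IsFollowCycle k T C) (hT : UniqueOut k T) (hp : p ∈ C) :
    TransGen (Follows k T) p p := by
  obtain ⟨p₀, h1, h2⟩ := hC
  rw [h2] at hp
  exact (TransGen.trans_right (hT.return h1 hp) h1).trans_left hp

lemma eq_of_mem (hC : IsFollowCycle k T C) (hC' : IsFollowCycle k T C') (hT : UniqueOut k T)
    (hp : p ∈ C) (hp' : p ∈ C') : C = C' := by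
  ext q
  rw [hC.mem_iff hT hp, hC'.mem_iff hT hp']

end IsFollowCycle

lemma isFollowCycle_of_closed {C : Finset (ι × Fin (n + 1))} {p : ι × Fin (n + 1)}
    (hp : TransGen (Follows k T) p p) (hpC : p ∈ C)
    (hC : ∀ q ∈ C, ReflTransGen (Follows k T) p q)
    (hcl : ∀ q ∈ C, ∀ q', Follows k T q q' → q' ∈ C) : IsFollowCycle k T C := by
  refine ⟨p, hp, fun q => ⟨hC q, fun hq => ?_⟩⟩
  induction hq with
  | refl => exact hpC
  | tail _ h ih => exact hcl _ ih _ h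

/-- A meta-edge in the graph `T i` as a walk for the relation `Follows`. -/
lemma ColoredGraph.IsMetaEdge.follows (hT : UniqueOut k T) {i i' : ι} {s t : Fin (n + 1)}
    {P : Finset (Fin (n + 1))} (h : (T i).IsMetaEdge s t P) (ht : (T i').HasOut t)
    (hi' : k < (t : ℕ) → i' = i) :
    s ∈ P ∧ TransGen (Follows k T) (i, s) (i', t) ∧
      (∀ x ∈ P, ReflTransGen (Follows k T) (i, s) (i, x)) ∧
      ∀ x ∈ P, ∀ q, Follows k T (i, x) q → q = (i', t) ∨ ∃ y ∈ P, q = (i, y) := by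
  obtain ⟨r, u, rfl, rfl, harc, -, -, rfl⟩ := h
  have hstep : ∀ j < r, Follows k T (i, u j) (i, u (j + 1)) := fun j hj =>
    ⟨harc j hj.le, ⟨_, harc (j + 1) hj⟩, fun _ => rfl⟩
  have hlast : Follows k T (i, u r) (i', u (r + 1)) := ⟨harc r le_rfl, ht, hi'⟩
  have hreach : ∀ j ≤ r, ReflTransGen (Follows k T) (i, u 0) (i, u j) := by
    intro j hj
    induction j with
    | zero => exact .refl
    | succ j ih => exact (ih (by omega)).tail (hstep j hj)
  refine ⟨Finset.mem_image_of_mem u (Finset.mem_range.2 (Nat.succ_pos r)),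
    TransGen.tail' (hreach r le_rfl) hlast, fun x hx => ?_, fun x hx q hq => ?_⟩
  · obtain ⟨j, hj, rfl⟩ := Finset.mem_image.1 hx
    exact hreach j (Nat.lt_succ_iff.1 (Finset.mem_range.1 hj))
  · obtain ⟨j, hj, rfl⟩ := Finset.mem_image.1 hx
    rcases (Nat.lt_succ_iff.1 (Finset.mem_range.1 hj)).lt_or_eq with hj' | rfl
    · exact .inr ⟨u (j + 1), Finset.mem_image_of_mem u (Finset.mem_range.2 (by omega)),
        hq.eq hT (hstep j hj')⟩
    · exact .inl (hq.eq hT hlast)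

end FollowCycles

/-! ### Admissible colorings and red permutations -/

section Coloring

open Relation

variable {n k k' : ℕ} {T : GraphTuple n k'} {e : ℤˣ}
  {Cyc : Finset (Fin k' × Fin (n + 1)) → Prop}

lemma IsRedPerm.isRed_of_reflTransGen (hT : UniqueOut k T)
    {σ : Equiv.Perm (Fin k' × Fin (n + 1))} (hσ : IsRedPerm k T σ) {p q : Fin k' × Fin (n + 1)}
    (hp : IsRed T p) (h : ReflTransGen (Follows k T) p q) : IsRed T q ∧ σ.SameCycle p q := by
  induction h with
  | refl => exact ⟨hp, Equiv.Perm.SameCycle.refl _ _⟩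
  | @tail b c _ h ih =>
    rw [h.eq hT (hσ.follows b ih.1)]
    exact ⟨hσ.isRed b ih.1, ih.2.trans (Equiv.Perm.sameCycle_apply_right.2 (.refl _ _))⟩

lemma IsRedPerm.reflTransGen {σ : Equiv.Perm (Fin k' × Fin (n + 1))} (hσ : IsRedPerm k T σ)
    {p q : Fin k' × Fin (n + 1)} (hp : IsRed T p) (h : σ.SameCycle p q) :
    ReflTransGen (Follows k T) p q := by
  obtain ⟨i, -, rfl⟩ := h.exists_pow_eq'
  have : ∀ i : ℕ, IsRed T ((σ ^ i) p) ∧ ReflTransGen (Follows k T) p ((σ ^ i) p) := by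
    intro i
    induction i with
    | zero => exact ⟨hp, .refl⟩
    | succ i ih =>
      rw [pow_succ', Equiv.Perm.mul_apply]
      exact ⟨hσ.isRed _ ih.1, ih.2.tail (hσ.follows _ ih.1)⟩
  exact (this i).2

open Classical in
lemma IsRedPerm.isFollowCycle (hT : UniqueOut k T) {σ : Equiv.Perm (Fin k' × Fin (n + 1))}
    (hσ : IsRedPerm k T σ) {p : Fin k' × Fin (n + 1)} (hp : IsRed T p) :
    IsFollowCycle k T (Finset.univ.filter (σ.SameCycle p)) := by
  refine ⟨p, TransGen.head' (hσ.follows p hp) (hσ.reflTransGen (hσ.isRed p hp)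
    (Equiv.Perm.sameCycle_apply_left.2 (.refl _ _))), fun q => ?_⟩
  rw [Finset.mem_filter, and_iff_right (Finset.mem_univ q)]
  exact ⟨hσ.reflTransGen hp, fun h => (hσ.isRed_of_reflTransGen hT hp h).2⟩

/-- Redness propagates along `Follows`, so one red edge makes its cycle red; and the `σ`-orbit of a
red edge is a cycle. -/
lemma HasSign.wellColored (hT : UniqueOut k T) (hC : ∀ C, Cyc C ↔ IsFollowCycle k T C)
    (h : HasSign k T e) : T.WellColored Cyc := by
  classical
  obtain ⟨σ, hσ, -⟩ := h
  refine ⟨fun C hCyc => ?_, fun i x hx => ?_⟩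
  · rw [hC] at hCyc
    by_cases hr : ∃ p ∈ C, IsRed T p
    · obtain ⟨p, hp, hr⟩ := hr
      refine .inl fun q hq => ?_
      exact (hσ.isRed_of_reflTransGen hT hr ((hCyc.mem_iff hT hp).1 hq)).1
    · refine .inr fun q hq => ?_
      push Not at hr
      obtain ⟨q', hq', -⟩ := TransGen.head'_iff.1 (hCyc.transGen hT hq)
      have hout : (T q.1).HasOut q.2 := ⟨_, hq'.1⟩
      exact hout.black_or_red.resolve_right (hr q hq)
  · exact ⟨_, (hC _).2 (hσ.isFollowCycle (p := (i, x)) hT hx), by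
      simp [Equiv.Perm.SameCycle.refl]⟩

lemma HasSign.neg_one_pow_numRed (hT : UniqueOut k T) (hC : ∀ C, Cyc C ↔ IsFollowCycle k T C)
    (h : HasSign k T e) : (-1) ^ T.numRed Cyc = e := by
  classical
  obtain ⟨σ, hσ, rfl⟩ := h
  rw [← Equiv.Perm.neg_one_pow_card_orbits σ _ fun p hp => hσ.fixed p (by simpa using hp),
    GraphTuple.numRed, ← Set.ncard_coe_finset]
  congr 2
  ext C
  simp only [Set.mem_ofPred_eq, Finset.coe_image, Set.mem_image, Finset.mem_coe,
    Finset.mem_filter, Finset.mem_univ, true_and]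
  rw [hC]
  constructor
  · rintro ⟨hc, hr⟩
    obtain ⟨p, hp⟩ := hc.nonempty
    exact ⟨p, hr p hp, (hσ.isFollowCycle hT (hr p hp)).eq_of_mem hc hT
      (by simp [Equiv.Perm.SameCycle.refl]) hp⟩
  · rintro ⟨p, hp, rfl⟩
    refine ⟨hσ.isFollowCycle hT hp, fun q hq => ?_⟩
    exact (hσ.isRed_of_reflTransGen hT hp (hσ.reflTransGen hp (by simpa using hq))).1

/-- Each red edge has a red successor and a red predecessor on its cycle. The successor map on red
edges is thus onto, hence bijective by finiteness, and is extended by the identity. -/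
lemma exists_hasSign (hT : UniqueOut k T) (hC : ∀ C, Cyc C ↔ IsFollowCycle k T C)
    (h : T.WellColored Cyc) : ∃ e, HasSign k T e := by
  classical
  have hcyc : ∀ p, IsRed T p → ∃ C, IsFollowCycle k T C ∧ p ∈ C ∧ ∀ q ∈ C, IsRed T q := by
    intro p hp
    obtain ⟨C, hCyc, hpC⟩ := h.2 p.1 p.2 hp
    refine ⟨C, (hC C).1 hCyc, hpC, (h.1 C hCyc).resolve_right fun hb => ?_⟩
    exact (hb p hpC).not_redOut hp
  have hnext : ∀ p : {p // IsRed T p}, ∃ q : {p // IsRed T p}, Follows k T p q := by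
    rintro ⟨p, hp⟩
    obtain ⟨C, h1, h2, h3⟩ := hcyc p hp
    obtain ⟨q, hq, -⟩ := TransGen.head'_iff.1 (h1.transGen hT h2)
    exact ⟨⟨q, h3 q ((h1.mem_iff hT h2).2 (.single hq))⟩, hq⟩
  choose f hf using hnext
  have hsurj : Function.Surjective f := by
    rintro ⟨q, hq⟩
    obtain ⟨C, h1, h2, h3⟩ := hcyc q hq
    obtain ⟨p, hp, hpq⟩ := TransGen.tail'_iff.1 (h1.transGen hT h2)
    exact ⟨⟨p, h3 p ((h1.mem_iff hT h2).2 hp)⟩, Subtype.ext ((hf _).eq hT hpq)⟩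
  let g : Equiv.Perm {p // IsRed T p} :=
    Equiv.ofBijective f ⟨Finite.injective_iff_surjective.2 hsurj, hsurj⟩
  have hg : ∀ p (hp : IsRed T p), Equiv.Perm.ofSubtype g p = f ⟨p, hp⟩ := fun p hp =>
    Equiv.Perm.ofSubtype_apply_of_mem g hp
  refine ⟨_, Equiv.Perm.ofSubtype g, ⟨fun p hp => ?_, fun p hp => ?_, fun p hp => ?_⟩, rfl⟩
  · rw [hg p hp]
    exact hf ⟨p, hp⟩
  · rw [hg p hp]
    exact (f ⟨p, hp⟩).2
  · exact Equiv.Perm.ofSubtype_apply_of_not_mem g hp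

lemma wellColored_iff_hasSign (hT : UniqueOut k T) (hC : ∀ C, Cyc C ↔ IsFollowCycle k T C) :
    (T.WellColored Cyc ∧ (-1) ^ T.numRed Cyc = e) ↔ HasSign k T e := by
  constructor
  · rintro ⟨h, rfl⟩
    obtain ⟨e, he⟩ := exists_hasSign hT hC h
    rwa [he.neg_one_pow_numRed hT hC]
  · exact fun h => ⟨h.wellColored hT hC, h.neg_one_pow_numRed hT hC⟩

end Coloring

open ColoredGraph

/-! ### Cycles and forbidden meta-cycles as successor cycles -/

section Cycles

open Relation

variable {n k k' : ℕ} {T : GraphTuple n k'} {C : Finset (Fin k' × Fin (n + 1))}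

lemma GraphTuple.IsCycle.isFollowCycle (hT : UniqueOut k T) (h : T.IsCycle C) :
    IsFollowCycle k T C := by
  obtain ⟨i, s, P, hP, rfl⟩ := h
  have hs : (T i).HasOut s := by
    obtain ⟨r, u, rfl, -, harc, -⟩ := hP
    exact ⟨_, harc 0 (Nat.zero_le r)⟩
  obtain ⟨h1, h2, h3, h4⟩ := hP.follows (k := k) hT hs fun _ => rfl
  refine isFollowCycle_of_closed h2 (Finset.mem_image_of_mem _ h1) (fun q hq => ?_)
    fun q hq q' hq' => ?_
  · obtain ⟨x, hx, rfl⟩ := Finset.mem_image.1 hq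
    exact h3 x hx
  · obtain ⟨x, hx, rfl⟩ := Finset.mem_image.1 hq
    rcases h4 x hx q' hq' with rfl | ⟨y, hy, rfl⟩
    · exact Finset.mem_image_of_mem _ h1
    · exact Finset.mem_image_of_mem _ hy

lemma IsFollowCycle.isCycle (hT : UniqueOut k T) (h : IsFollowCycle k T C)
    (hi : ∀ p ∈ C, ∀ q ∈ C, p.1 = q.1) : T.IsCycle C := by
  obtain ⟨p, hp⟩ := h.nonempty
  have hpath : ∀ q, TransGen (Follows k T) p q → q ∈ C ∧ TransGen (T p.1).Arc p.2 q.2 := by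
    intro q hq
    induction hq with
    | single hq => exact ⟨(h.mem_iff hT hp).2 (.single hq), .single hq.1⟩
    | @tail b c hb hbc ih =>
      refine ⟨(h.mem_iff hT ih.1).2 (.single hbc), ih.2.tail ?_⟩
      rw [hi p hp b ih.1]
      exact hbc.1
  obtain ⟨P, hP⟩ := exists_isMetaEdge (hpath p (h.transGen hT hp)).2
  have hcyc : T.IsCycle (P.image fun x => (p.1, x)) := ⟨_, _, _, hP, rfl⟩
  have hmem : p ∈ P.image fun x => (p.1, x) := by
    obtain ⟨r, u, hu, -, -, -, -, rfl⟩ := hP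
    refine Finset.mem_image.2 ⟨p.2, ?_, rfl⟩
    exact Finset.mem_image.2 ⟨0, Finset.mem_range.2 (Nat.succ_pos r), hu⟩
  rwa [h.eq_of_mem (hcyc.isFollowCycle hT) hT hp hmem]

lemma GraphTuple.IsForbiddenMetaCycle.isFollowCycle (hT : UniqueOut k T)
    (hn : ∀ i : Fin k', (GraphTuple.node n i : ℕ) ≤ k) (h : T.IsForbiddenMetaCycle C) :
    IsFollowCycle k T C := by
  obtain ⟨r, a, P, -, hP, rfl⟩ := h
  have hout : ∀ j, (T (a j)).HasOut (GraphTuple.node n (a j)) := fun j => by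
    obtain ⟨l, u, hu, -, harc, -⟩ := hP j
    exact ⟨_, hu ▸ harc 0 (Nat.zero_le l)⟩
  have key := fun j => (hP j).follows (k := k) hT (hout (j + 1))
    fun hk => absurd hk (not_lt.2 (hn _))
  have hmem : ∀ j, ∀ x ∈ P j, (a j, x) ∈
      Finset.univ.biUnion fun j => (P j).image fun x => (a j, x) := fun j x hx =>
    Finset.mem_biUnion.2 ⟨j, Finset.mem_univ j, Finset.mem_image_of_mem _ hx⟩
  have hreach : ∀ j, ReflTransGen (Follows k T) (a 0, GraphTuple.node n (a 0))
      (a j, GraphTuple.node n (a j)) := by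
    intro j
    induction j using Fin.induction with
    | zero => exact .refl
    | succ j ih =>
      have := (key j.castSucc).2.1
      rw [Fin.coeSucc_eq_succ] at this
      exact ih.trans this.to_reflTransGen
  have hloop := TransGen.trans_right (hreach (Fin.last r)) (key (Fin.last r)).2.1
  rw [Fin.last_add_one] at hloop
  refine isFollowCycle_of_closed hloop (hmem 0 _ (key 0).1) (fun q hq => ?_) fun q hq q' hq' => ?_
  · obtain ⟨j, -, hq⟩ := Finset.mem_biUnion.1 hq
    obtain ⟨x, hx, rfl⟩ := Finset.mem_image.1 hq
    exact (hreach j).trans ((key j).2.2.1 x hx)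
  · obtain ⟨j, -, hq⟩ := Finset.mem_biUnion.1 hq
    obtain ⟨x, hx, rfl⟩ := Finset.mem_image.1 hq
    rcases (key j).2.2.2 x hx q' hq' with rfl | ⟨y, hy, rfl⟩
    · exact hmem (j + 1) _ (key (j + 1)).1
    · exact hmem j y hy

/-- A walk to an edge out of a special node has its first special node in the same graph. -/
lemma exists_transGen_special {p q : Fin k' × Fin (n + 1)} (h : TransGen (Follows k T) p q)
    (hq : (q.2 : ℕ) ≤ k) :
    ∃ q', (q'.2 : ℕ) ≤ k ∧ ReflTransGen (Follows k T) p q' ∧ (T q'.1).HasOut q'.2 ∧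
      TransGen (T p.1).Arc p.2 q'.2 := by
  have key : ∀ q, TransGen (Follows k T) p q →
      (∃ q', (q'.2 : ℕ) ≤ k ∧ ReflTransGen (Follows k T) p q' ∧ (T q'.1).HasOut q'.2 ∧
        TransGen (T p.1).Arc p.2 q'.2) ∨
      (k < (q.2 : ℕ) ∧ q.1 = p.1 ∧ TransGen (T p.1).Arc p.2 q.2) := by
    intro q hq
    induction hq with
    | @single b h =>
      rcases le_or_gt (b.2 : ℕ) k with hb | hb
      · exact .inl ⟨b, hb, .single h, h.2.1, .single h.1⟩
      · exact .inr ⟨hb, h.2.2 hb, .single h.1⟩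
    | @tail b c hb hbc ih =>
      rcases ih with ih | ⟨-, hbi, ih⟩
      · exact .inl ih
      · have harc := hbc.1
        rw [hbi] at harc
        rcases le_or_gt (c.2 : ℕ) k with hc | hc
        · exact .inl ⟨c, hc, hb.to_reflTransGen.tail hbc, hbc.2.1, ih.tail harc⟩
        · exact .inr ⟨hc, (hbc.2.2 hc).trans hbi, ih.tail harc⟩
  exact (key q h).resolve_right fun h0 => absurd hq (not_le.2 h0.1)

lemma IsFollowCycle.isForbiddenMetaCycle (hT : UniqueOut k T)
    (hn : ∀ i : Fin k', (GraphTuple.node n i : ℕ) ≤ k)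
    (hs : ∀ (i : Fin k') (x : Fin (n + 1)), (x : ℕ) ≤ k → (T i).HasOut x → x = GraphTuple.node n i)
    (h : IsFollowCycle k T C) {p : Fin k' × Fin (n + 1)} (hp : p ∈ C) (hpk : (p.2 : ℕ) ≤ k) :
    T.IsForbiddenMetaCycle C := by
  have hout : ∀ q ∈ C, (T q.1).HasOut q.2 := fun q hq => by
    obtain ⟨q', hq', -⟩ := TransGen.head'_iff.1 (h.transGen hT hq)
    exact ⟨_, hq'.1⟩
  have hnext : ∀ a : {a : Fin k' // (a, GraphTuple.node n a) ∈ C},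
      ∃ (b : {a : Fin k' // (a, GraphTuple.node n a) ∈ C}) (P : Finset (Fin (n + 1))),
        (T a).IsMetaEdge (GraphTuple.node n a.1) (GraphTuple.node n b.1) P := by
    rintro ⟨a, ha⟩
    obtain ⟨q, hq, hr, ho, ht⟩ := exists_transGen_special (h.transGen hT ha) (hn a)
    have hqa := hs q.1 q.2 hq ho
    have hqC := (h.mem_iff hT ha).2 hr
    rw [hqa] at ht
    obtain ⟨P, hP⟩ := exists_isMetaEdge ht
    exact ⟨⟨q.1, by rw [← hqa]; exact hqC⟩, P, hP⟩
  choose f P hP using hnext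
  have hpC : (p.1, GraphTuple.node n p.1) ∈ C := by
    rw [← hs p.1 p.2 hpk (hout p hp)]
    exact hp
  -- `f` leads from one special edge of `C` to another along a meta-edge. A periodic point closes up
  -- a meta-cycle, and taking the minimal period makes its indices distinct. Sharing an edge with
  -- `C`, it equals `C`.
  obtain ⟨a, ha⟩ : ∃ a, a ∈ Function.periodicPts f := by
    obtain ⟨i, j, hij, he⟩ := Finite.exists_ne_map_eq_of_infinite fun i : ℕ => f^[i] ⟨p.1, hpC⟩
    wlog hlt : i < j generalizing i j
    · exact this j i hij.symm he.symm (by omega)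
    · refine ⟨f^[i] ⟨p.1, hpC⟩, j - i, by omega, ?_⟩
      rw [Function.IsPeriodicPt, Function.IsFixedPt, ← Function.iterate_add_apply,
        Nat.sub_add_cancel hlt.le]
      exact he.symm
  obtain ⟨r, hr⟩ := Nat.exists_eq_succ_of_ne_zero
    (Function.minimalPeriod_pos_of_mem_periodicPts ha).ne'
  let b : Fin (r + 1) → {a : Fin k' // (a, GraphTuple.node n a) ∈ C} := fun j => f^[j] a
  have hb : ∀ j, b (j + 1) = f (b j) := fun j => by
    have h1 : ((j + 1 : Fin (r + 1)) : ℕ) = (j + 1) % Function.minimalPeriod f a := by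
      rw [hr, Fin.val_add, Fin.val_one', Nat.add_mod_mod]
    change f^[((j + 1 : Fin (r + 1)) : ℕ)] a = f (f^[(j : ℕ)] a)
    rw [h1, Function.iterate_mod_minimalPeriod_eq, Function.iterate_succ_apply']
  have hinj : Function.Injective b := fun i j hij => by
    refine Fin.ext (Function.iterate_injOn_Iio_minimalPeriod (f := f) (x := a) ?_ ?_ hij)
    · rw [Set.mem_Iio, hr]; exact i.isLt
    · rw [Set.mem_Iio, hr]; exact j.isLt
  have hmeta : T.IsForbiddenMetaCycle
      (Finset.univ.biUnion fun j => (P (b j)).image fun x => ((b j).1, x)) := by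
    refine ⟨r, fun j => (b j).1, fun j => P (b j), Subtype.val_injective.comp hinj, fun j => ?_,
      rfl⟩
    dsimp only
    rw [hb]
    exact hP (b j)
  have hmem : ((b 0).1, GraphTuple.node n (b 0).1) ∈
      Finset.univ.biUnion fun j => (P (b j)).image fun x => ((b j).1, x) := by
    refine Finset.mem_biUnion.2 ⟨0, Finset.mem_univ _, Finset.mem_image_of_mem _ ?_⟩
    obtain ⟨l, u, hu, -, -, -, -, he⟩ := hP (b 0)
    rw [he]
    exact Finset.mem_image.2 ⟨0, Finset.mem_range.2 (Nat.succ_pos l), hu⟩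
  rwa [h.eq_of_mem (hmeta.isFollowCycle hT hn) hT (b 0).2 hmem]

end Cycles

/-! ### The two ends of the algorithm: `S₁` and `S₂` -/

section Bridge

open Relation

variable {n r : ℕ} {Γ : Digraph (Fin (n + 1))} {e : ℤˣ} {T : GraphTuple n (r + 1)}

lemma isCycle_iff_isFollowCycle
    (h : ∀ (i : Fin (r + 1)) (x : Fin (n + 1)),
      (T i).HasOut x ↔ if (i : ℕ) = 0 then x ≠ 0 else r + 1 < (x : ℕ))
    (C : Finset (Fin (r + 1) × Fin (n + 1))) :
    T.IsCycle C ↔ IsFollowCycle (r + 1) T C := by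
  have hzero : ∀ (i : Fin (r + 1)) (x : Fin (n + 1)), (x : ℕ) ≤ r + 1 → (T i).HasOut x → i = 0 := by
    intro i x hx hi
    rw [h] at hi
    by_contra h0
    have h0' : (i : ℕ) ≠ 0 := fun h1 => h0 (Fin.ext h1)
    rw [if_neg h0'] at hi
    omega
  have hT : UniqueOut (r + 1) T := fun x i j hx hi hj =>
    (hzero i x hx hi).trans (hzero j x hx hj).symm
  refine ⟨fun hC => hC.isFollowCycle hT, fun hC => hC.isCycle hT ?_⟩
  -- Only the first graph has edges out of special nodes, so a walk can change graphs only into it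
  -- and never leaves it. A closed walk therefore stays in one graph.
  have hstep : ∀ p q, Follows (r + 1) T p q → q.1 = 0 ∨ q.1 = p.1 := fun p q hpq =>
    (le_or_gt (q.2 : ℕ) (r + 1)).imp (fun hq => hzero _ _ hq hpq.2.1) hpq.2.2
  have hwalk : ∀ p q, ReflTransGen (Follows (r + 1) T) p q → q.1 = 0 ∨ q.1 = p.1 := by
    intro p q hpq
    induction hpq with
    | refl => exact .inr rfl
    | tail _ hbc ih =>
      rcases hstep _ _ hbc with h1 | h1
      · exact .inl h1
      · rwa [h1]
  intro p hp q hq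
  rcases hwalk p q ((hC.mem_iff hT hp).1 hq) with h1 | h1
  · rcases hwalk q p ((hC.mem_iff hT hq).1 hp) with h2 | h2
    · rw [h1, h2]
    · exact h2
  · exact h1.symm

lemma node_val (hn : r + 1 ≤ n) (i : Fin (r + 1)) : (GraphTuple.node n i : ℕ) = i + 1 := by
  rw [GraphTuple.node, Fin.val_ofNat]
  exact Nat.mod_eq_of_lt (by omega)

lemma uniqueOut_of_hasOut_node (hn : r + 1 ≤ n)
    (h : ∀ (i : Fin (r + 1)) (x : Fin (n + 1)),
      (T i).HasOut x ↔ r + 1 < (x : ℕ) ∨ x = GraphTuple.node n i) : UniqueOut (r + 1) T := by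
  intro x i j hx hi hj
  rw [h] at hi hj
  have h1 := hi.resolve_left (by omega)
  have h2 := congrArg Fin.val (h1.symm.trans (hj.resolve_left (by omega)))
  rw [node_val hn, node_val hn] at h2
  ext
  omega

lemma isCycle₂_iff_isFollowCycle (hn : r + 1 ≤ n)
    (h : ∀ (i : Fin (r + 1)) (x : Fin (n + 1)),
      (T i).HasOut x ↔ r + 1 < (x : ℕ) ∨ x = GraphTuple.node n i)
    (C : Finset (Fin (r + 1) × Fin (n + 1))) :
    T.IsCycle₂ C ↔ IsFollowCycle (r + 1) T C := by
  have hT := uniqueOut_of_hasOut_node hn h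
  have hnode : ∀ i : Fin (r + 1), (GraphTuple.node n i : ℕ) ≤ r + 1 := fun i => by
    rw [node_val hn]
    omega
  refine ⟨?_, fun hC => ?_⟩
  · rintro (hC | hC)
    · exact hC.isFollowCycle hT
    · exact hC.isFollowCycle hT hnode
  · by_cases hp : ∃ p ∈ C, (p.2 : ℕ) ≤ r + 1
    · obtain ⟨p, hp, hpk⟩ := hp
      refine .inr (hC.isForbiddenMetaCycle hT hnode (fun i x hx hi => ?_) hp hpk)
      exact ((h i x).1 hi).resolve_left (by omega)
    · push Not at hp
      refine .inl (hC.isCycle hT fun p hpC q hqC => ?_)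
      have hr := (hC.mem_iff hT hpC).1 hqC
      clear hqC
      induction hr with
      | refl => rfl
      | tail hb hbc ih =>
        exact ih.trans (hbc.2.2 (hp _ ((hC.mem_iff hT hpC).2 (hb.tail hbc)))).symm

lemma toTuple_first (T : GraphTuple n (r + 1)) :
    PiTau.toTuple (T 0, Fin.tail T) = fun l => T ((finSuccEquiv r).symm l) := by
  funext l
  cases l
  · simp [PiTau.toTuple]
  · simp [PiTau.toTuple, Fin.tail]

lemma toTuple_last (T : GraphTuple n (r + 1)) :
    PiTau.toTuple (T (Fin.last r), Fin.init T) = fun l => T (finSuccEquivLast.symm l) := by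
  funext l
  cases l
  · simp [PiTau.toTuple]
  · simp [PiTau.toTuple, Fin.init]

lemma hasSign_reindex_iff {k : ℕ} {ι κ : Type*} [Fintype ι] [DecidableEq ι] [Fintype κ]
    [DecidableEq κ] {T : ι → ColoredGraph n} (f : κ ≃ ι) :
    HasSign k (fun i => T (f i)) e ↔ HasSign k T e := by
  refine ⟨fun h => ?_, HasSign.reindex f⟩
  have := h.reindex f.symm
  simpa using this

lemma memS₁_iff_level :
    (T.MemS₁ Γ ∧ (-1) ^ T.numRed T.IsCycle = e) ↔ Level Γ 0 e (T 0, Fin.tail T) := by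
  have hadj : T.EdgesIn Γ ↔
      ∀ l x y, (PiTau.toTuple (T 0, Fin.tail T) l).Arc x y → Γ.Adj x y := by
    rw [toTuple_first]
    exact ((finSuccEquiv r).symm.forall_congr_right
      (q := fun i => ∀ x y, (T i).Arc x y → Γ.Adj x y)).symm
  have hsign : HasSign (r + 1) T e ↔ HasSign (r + 1) (PiTau.toTuple (T 0, Fin.tail T)) e := by
    rw [toTuple_first, hasSign_reindex_iff]
  have hout : (∀ (i : Fin (r + 1)) (x : Fin (n + 1)),
      (T i).HasOut x ↔ if (i : ℕ) = 0 then x ≠ 0 else r + 1 < (x : ℕ)) ↔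
      (∀ x : Fin (n + 1), (T 0).HasOut x ↔ 0 < (x : ℕ)) ∧
      ∀ (j : Fin r) (x : Fin (n + 1)), (Fin.tail T j).HasOut x ↔
        r + 1 < (x : ℕ) ∨ ((x : ℕ) = j + 1 ∧ (j : ℕ) < 0) := by
    rw [Fin.forall_fin_succ]
    refine and_congr (forall_congr' fun x => ?_) (forall_congr' fun j => forall_congr' fun x => ?_)
    · rw [if_pos (Fin.val_zero _), ← Fin.pos_iff_ne_zero, Fin.lt_def, Fin.val_zero]
    · rw [if_neg (by simp)]
      simp [Fin.tail]
  constructor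
  · rintro ⟨⟨h1, h2, h3⟩, h4⟩
    refine ⟨Nat.zero_le r, hadj.1 h1, (hout.1 h2).1, (hout.1 h2).2, hsign.1 ?_⟩
    refine (wellColored_iff_hasSign ?_ (isCycle_iff_isFollowCycle h2)).1 ⟨h3, h4⟩
    intro x i j hx hi hj
    rw [h2] at hi hj
    split_ifs at hi hj
    · ext; omega
    all_goals omega
  · intro h
    have h2 := hout.2 ⟨h.out_pi, h.out_tau⟩
    have hT : UniqueOut (r + 1) T := by
      intro x i j hx hi hj
      rw [h2] at hi hj
      split_ifs at hi hj
      · ext; omega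
      all_goals omega
    have h3 := (wellColored_iff_hasSign hT (isCycle_iff_isFollowCycle h2)).2 (hsign.2 h.sign)
    exact ⟨⟨hadj.2 h.adj, h2, h3.1⟩, h3.2⟩

lemma memS₂_iff_level (hn : r + 1 ≤ n) :
    (T.MemS₂ Γ ∧ (-1) ^ T.numRed T.IsCycle₂ = e) ↔
      Level Γ r e (T (Fin.last r), Fin.init T) := by
  have hadj : T.EdgesIn Γ ↔
      ∀ l x y, (PiTau.toTuple (T (Fin.last r), Fin.init T) l).Arc x y → Γ.Adj x y := by
    rw [toTuple_last]
    exact ((finSuccEquivLast (n := r)).symm.forall_congr_right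
      (q := fun i => ∀ x y, (T i).Arc x y → Γ.Adj x y)).symm
  have hsign : HasSign (r + 1) T e ↔
      HasSign (r + 1) (PiTau.toTuple (T (Fin.last r), Fin.init T)) e := by
    rw [toTuple_last, hasSign_reindex_iff]
  have hout : (∀ (i : Fin (r + 1)) (x : Fin (n + 1)),
      (T i).HasOut x ↔ r + 1 < (x : ℕ) ∨ x = GraphTuple.node n i) ↔
      (∀ x : Fin (n + 1), (T (Fin.last r)).HasOut x ↔ r < (x : ℕ)) ∧
      ∀ (j : Fin r) (x : Fin (n + 1)), (Fin.init T j).HasOut x ↔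
        r + 1 < (x : ℕ) ∨ ((x : ℕ) = j + 1 ∧ (j : ℕ) < r) := by
    rw [Fin.forall_fin_succ', and_comm]
    refine and_congr (forall_congr' fun x => ?_) (forall_congr' fun j => forall_congr' fun x => ?_)
    · rw [Fin.ext_iff, node_val hn, Fin.val_last]
      refine iff_congr Iff.rfl ?_
      omega
    · rw [Fin.ext_iff, node_val hn, Fin.val_castSucc]
      refine iff_congr Iff.rfl ?_
      omega
  constructor
  · rintro ⟨⟨h1, h2, h3⟩, h4⟩
    refine ⟨le_rfl, hadj.1 h1, (hout.1 h2).1, (hout.1 h2).2, hsign.1 ?_⟩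
    exact (wellColored_iff_hasSign (uniqueOut_of_hasOut_node hn h2)
      (isCycle₂_iff_isFollowCycle hn h2)).1 ⟨h3, h4⟩
  · intro h
    have h2 := hout.2 ⟨h.out_pi, h.out_tau⟩
    have h3 := (wellColored_iff_hasSign (uniqueOut_of_hasOut_node hn h2)
      (isCycle₂_iff_isFollowCycle hn h2)).2 (hsign.2 h.sign)
    exact ⟨⟨hadj.2 h.adj, h2, h3.1⟩, h3.2⟩

lemma mem_pos_difference_iff (hn : r + 1 ≤ n) (x : GraphTuple n (r + 1) ⊕ GraphTuple n (r + 1)) :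
    x ∈ ((S₁ (r + 1) Γ).difference (S₂ (r + 1) Γ)).pos ↔ DifferenceLevel Γ 1 x := by
  rcases x with T | T
  · rw [DifferenceLevel, ← memS₁_iff_level, neg_one_pow_eq_one_iff_even (by decide)]
    simp [SignedSet.difference, S₁]
  · rw [DifferenceLevel, ← memS₂_iff_level hn, neg_one_pow_eq_neg_one_iff_odd (by decide)]
    simp [SignedSet.difference, S₂]

lemma mem_neg_difference_iff (hn : r + 1 ≤ n) (x : GraphTuple n (r + 1) ⊕ GraphTuple n (r + 1)) :
    x ∈ ((S₁ (r + 1) Γ).difference (S₂ (r + 1) Γ)).neg ↔ DifferenceLevel Γ (-1) x := by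
  rcases x with T | T
  · rw [DifferenceLevel, ← memS₁_iff_level, neg_one_pow_eq_neg_one_iff_odd (by decide)]
    simp [SignedSet.difference, S₁]
  · rw [DifferenceLevel, neg_neg, ← memS₂_iff_level hn, neg_one_pow_eq_one_iff_even (by decide)]
    simp [SignedSet.difference, S₂]

end Bridge

theorem mainTheorem4 (n r : ℕ) (hk : r + 1 ≤ n) (Γ : Digraph (Fin (n + 1))) :
    ((S₁ (r + 1) Γ).difference (S₂ (r + 1) Γ)).IsInvolution phi₁ ∧
    ((S₁ (r + 1) Γ).difference (S₂ (r + 1) Γ)).IsSignReversing phi₁ := by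
  have hpos : ∀ x ∈ ((S₁ (r + 1) Γ).difference (S₂ (r + 1) Γ)).pos,
      phi₁ x ∈ ((S₁ (r + 1) Γ).difference (S₂ (r + 1) Γ)).neg ∧ phi₁ (phi₁ x) = x := by
    intro x hx
    rw [mem_pos_difference_iff hk] at hx
    rw [mem_neg_difference_iff hk]
    exact hx.phi₁ hk
  have hneg : ∀ x ∈ ((S₁ (r + 1) Γ).difference (S₂ (r + 1) Γ)).neg,
      phi₁ x ∈ ((S₁ (r + 1) Γ).difference (S₂ (r + 1) Γ)).pos ∧ phi₁ (phi₁ x) = x := by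
    intro x hx
    rw [mem_neg_difference_iff hk] at hx
    have := hx.phi₁ hk
    rwa [neg_neg, ← mem_pos_difference_iff hk] at this
  refine ⟨⟨fun x hx => ?_, fun x hx => ?_⟩, fun x hx => (hpos x hx).1, fun x hx => (hneg x hx).1⟩
  · exact hx.elim (fun hx => .inr (hpos x hx).1) fun hx => .inl (hneg x hx).1
  · exact hx.elim (fun hx => (hpos x hx).2) fun hx => (hneg x hx).2
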